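/- Let $M$ be a finite-dimensional paracompact (Hausdorff) $C^\infty$ manifold, and let $L$ be a smooth vector $1$-form on $M$ (a smooth field of endomorphisms of the tangent spaces) with vanishing Nijenhuis tensor $\tfrac12[L,L]=0$ and with $\operatorname{Im} L_z=\operatorname{Ker} L_z$ for every $z\in M$, where $[\cdot,\cdot]$ is the Frölicher–Nijenhuis bracket. Let $\Gamma$ be an $L$-connection on $M$, i.e. a smooth vector $1$-form with $L\Gamma=L$ and $\Gamma L=-L$. Let $h=\tfrac12(I+\Gamma)$ be its horizontal projector, $H_z=\operatorname{Im}h_z$ the horizontal space at $z$, $R=-\tfrac12[h,h]$ the curvature of $\Gamma$, $N_R(z)=\{X\in H_z : i_XR=0\}$ the nullity space of $R$ at $z$, and $\mu_R(z)=\dim N_R(z)$ the nullity index. If $\mu_R$ is constant on an open set $U\subset M$, then the nullity distribution $N_R$ is completely integrable on $U$: every point of $U$ has a neighbourhood in $U$ with smooth coordinates $(x^1,\dots,x^{d})$ of $M$, where $d=\dim M$, in which, at every point $z$, $N_R(z)$ is spanned by $\partial/\partial x^1,\dots,\partial/\partial x^k$, where $k$ is the constant value of $\mu_R$ on $U$.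 -/

import Mathlib

open scoped Manifold ContDiff

noncomputable section

namespace LConn

section Forms

variable {E : Type*} [NormedAddCommGroup E] [NormedSpace ℝ E]
  {M : Type*} [TopologicalSpace M] [ChartedSpace E M]

/-- Vector fields on `M`, with no regularity assumed. -/
abbrev VField (E : Type*) [NormedAddCommGroup E] [NormedSpace ℝ E]
    (M : Type*) [TopologicalSpace M] [ChartedSpace E M] : Type _ :=
  (z : M) → TangentSpace 𝓘(ℝ, E) z

/-- Smooth vector `1`-forms on `M`: smooth fields of endomorphisms of the tangent spaces. -/
abbrev VectorOneForm (E : Type*) [NormedAddCommGroup E] [NormedSpace ℝ E]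
    (M : Type*) [TopologicalSpace M] [ChartedSpace E M] [IsManifold 𝓘(ℝ, E) ∞ M] : Type _ :=
  Cₛ^∞⟮𝓘(ℝ, E); E →L[ℝ] E,
    fun z : M => TangentSpace 𝓘(ℝ, E) z →L[ℝ] TangentSpace 𝓘(ℝ, E) z⟯

variable [IsManifold 𝓘(ℝ, E) ∞ M]

/-- The vector field `K X` obtained by applying a vector `1`-form to a vector field. -/
def VectorOneForm.app (K : VectorOneForm E M) (X : VField E M) : VField E M :=
  fun z => K z (X z)

/-- The identity vector `1`-form. -/
def idForm (E : Type*) [NormedAddCommGroup E] [NormedSpace ℝ E]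
    (M : Type*) [TopologicalSpace M] [ChartedSpace E M] [IsManifold 𝓘(ℝ, E) ∞ M] :
    VectorOneForm E M where
  toFun z := ContinuousLinearMap.id ℝ (TangentSpace 𝓘(ℝ, E) z)
  contMDiff_toFun := by
    intro z₀
    rw [contMDiffAt_hom_bundle]
    refine ⟨contMDiffAt_id, ?_⟩
    refine (contMDiffAt_const (c := ContinuousLinearMap.id ℝ E)).congr_of_eventuallyEq ?_
    have hmem : (trivializationAt E (TangentSpace 𝓘(ℝ, E)) z₀).baseSet ∈ nhds z₀ :=
      (trivializationAt E (TangentSpace 𝓘(ℝ, E)) z₀).open_baseSet.mem_nhds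
        (FiberBundle.mem_baseSet_trivializationAt' z₀)
    filter_upwards [hmem] with z hz
    ext v
    simp only [ContinuousLinearMap.inCoordinates, ContinuousLinearMap.id_comp,
      ContinuousLinearMap.comp_apply, ContinuousLinearMap.id_apply]
    exact (trivializationAt E (TangentSpace 𝓘(ℝ, E)) z₀).continuousLinearMapAt_symmL hz v

open VectorField in
/-- The Frölicher-Nijenhuis bracket of two vector `1`-forms, evaluated on two vector fields
at a point. -/
def fnBracketField (K K' : VectorOneForm E M) (X Y : VField E M) (z : M) :
    TangentSpace 𝓘(ℝ, E) z :=
  mlieBracket 𝓘(ℝ, E) (K.app X) (K'.app Y) z + mlieBracket 𝓘(ℝ, E) (K'.app X) (K.app Y) z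
    + K z (K' z (mlieBracket 𝓘(ℝ, E) X Y z)) + K' z (K z (mlieBracket 𝓘(ℝ, E) X Y z))
    - K z (mlieBracket 𝓘(ℝ, E) (K'.app X) Y z) - K z (mlieBracket 𝓘(ℝ, E) X (K'.app Y) z)
    - K' z (mlieBracket 𝓘(ℝ, E) (K.app X) Y z) - K' z (mlieBracket 𝓘(ℝ, E) X (K.app Y) z)

theorem VectorOneForm.app_mdifferentiableAt (K : VectorOneForm E M) {X : VField E M} {z : M}
    (hX : MDiffAt (T% X) z) : MDiffAt (T% (K.app X)) z :=
  MDifferentiableAt.clm_bundle_apply ((K.contMDiff z).mdifferentiableAt (by simp)) hX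

theorem VectorOneForm.app_smul (K : VectorOneForm E M) (f : M → ℝ) (X : VField E M) :
    K.app (f • X) = f • K.app X := by
  funext z; simp [VectorOneForm.app]

theorem VectorOneForm.app_add (K : VectorOneForm E M) (X Y : VField E M) :
    K.app (X + Y) = K.app X + K.app Y := by
  funext z; simp [VectorOneForm.app]

variable [FiniteDimensional ℝ E]

theorem fnBracketField_tensorial_left (K K' : VectorOneForm E M) (z : M) (Y : VField E M) :
    TensorialAt 𝓘(ℝ, E) E (fun X => fnBracketField K K' X Y z) z := by
  have : CompleteSpace E := FiniteDimensional.complete ℝ E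
  constructor
  · intro f X hf hX
    have h1 := K.app_mdifferentiableAt hX
    have h2 := K'.app_mdifferentiableAt hX
    simp only [fnBracketField, VectorOneForm.app_smul,
      VectorField.mlieBracket_smul_left hf hX, VectorField.mlieBracket_smul_left hf h1,
      VectorField.mlieBracket_smul_left hf h2, map_add, map_smul]
    simp only [VectorOneForm.app]
    module
  · intro X X' hX hX'
    have h1 := K.app_mdifferentiableAt hX
    have h2 := K'.app_mdifferentiableAt hX
    have h1' := K.app_mdifferentiableAt hX'
    have h2' := K'.app_mdifferentiableAt hX'
    simp only [fnBracketField, VectorOneForm.app_add,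
      VectorField.mlieBracket_add_left hX hX', VectorField.mlieBracket_add_left h1 h1',
      VectorField.mlieBracket_add_left h2 h2', map_add]
    module

theorem fnBracketField_tensorial_right (K K' : VectorOneForm E M) (z : M) (X : VField E M) :
    TensorialAt 𝓘(ℝ, E) E (fun Y => fnBracketField K K' X Y z) z := by
  have : CompleteSpace E := FiniteDimensional.complete ℝ E
  constructor
  · intro f Y hf hY
    have h1 := K.app_mdifferentiableAt hY
    have h2 := K'.app_mdifferentiableAt hY
    simp only [fnBracketField, VectorOneForm.app_smul,
      VectorField.mlieBracket_smul_right hf hY, VectorField.mlieBracket_smul_right hf h1,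
      VectorField.mlieBracket_smul_right hf h2, map_add, map_smul]
    simp only [VectorOneForm.app]
    module
  · intro Y Y' hY hY'
    have h1 := K.app_mdifferentiableAt hY
    have h2 := K'.app_mdifferentiableAt hY
    have h1' := K.app_mdifferentiableAt hY'
    have h2' := K'.app_mdifferentiableAt hY'
    simp only [fnBracketField, VectorOneForm.app_add,
      VectorField.mlieBracket_add_right hY hY', VectorField.mlieBracket_add_right h1 h1',
      VectorField.mlieBracket_add_right h2 h2', map_add]
    module

/-- The Frölicher-Nijenhuis bracket `[K, K']` of two vector `1`-forms, as a vector `2`-form. -/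
def fnBracket (K K' : VectorOneForm E M) (z : M) :
    TangentSpace 𝓘(ℝ, E) z →L[ℝ] TangentSpace 𝓘(ℝ, E) z →L[ℝ] TangentSpace 𝓘(ℝ, E) z :=
  TensorialAt.mkHom₂ (fun X Y => fnBracketField K K' X Y z) z
    (fun Y _ => fnBracketField_tensorial_left K K' z Y)
    (fun X _ => fnBracketField_tensorial_right K K' z X)

/-- `[K, K']` takes the expected value on all vector fields that are differentiable at `z`. -/
theorem fnBracket_apply (K K' : VectorOneForm E M) {X Y : VField E M} {z : M}
    (hX : MDiffAt (T% X) z) (hY : MDiffAt (T% Y) z) :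
    fnBracket K K' z (X z) (Y z) = fnBracketField K K' X Y z :=
  TensorialAt.mkHom₂_apply (Φ := fun X Y => fnBracketField K K' X Y z) _ _ hX hY

/-- `L` has vanishing Nijenhuis tensor `½[L, L]`, and its image and kernel coincide at every
point. (The latter forces `dim M = 2n` and `rank L = n`.) -/
structure IsAlmostTangent (L : VectorOneForm E M) : Prop where
  nijenhuis_eq_zero : ∀ z, (1 / 2 : ℝ) • fnBracket L L z = 0
  range_eq_ker : ∀ z, LinearMap.range (L z).toLinearMap = LinearMap.ker (L z).toLinearMap

/-- `Γ` is an `L`-connection: `L Γ = L` and `Γ L = -L`. -/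
structure IsConnection (L Γ : VectorOneForm E M) : Prop where
  comp_left : ∀ z, (L z).comp (Γ z) = L z
  comp_right : ∀ z, (Γ z).comp (L z) = -L z

/-- The horizontal projector `h = ½(I + Γ)`. -/
def horProj (Γ : VectorOneForm E M) : VectorOneForm E M :=
  (1 / 2 : ℝ) • (idForm E M + Γ)

/-- The horizontal space `H_z = Im h_z`. -/
def horSpace (Γ : VectorOneForm E M) (z : M) : Submodule ℝ (TangentSpace 𝓘(ℝ, E) z) :=
  LinearMap.range (horProj Γ z).toLinearMap

/-- The curvature `R = -½[h, h]`. -/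
def curvature (Γ : VectorOneForm E M) (z : M) :
    TangentSpace 𝓘(ℝ, E) z →L[ℝ] TangentSpace 𝓘(ℝ, E) z →L[ℝ] TangentSpace 𝓘(ℝ, E) z :=
  -((1 / 2 : ℝ) • fnBracket (horProj Γ) (horProj Γ) z)

/-- The nullity space `N_R(z) = {X ∈ H_z : i_X R = 0}` of the curvature. -/
def nullity (Γ : VectorOneForm E M) (z : M) : Submodule ℝ (TangentSpace 𝓘(ℝ, E) z) :=
  horSpace Γ z ⊓ LinearMap.ker (curvature Γ z).toLinearMap

theorem mem_nullity (Γ : VectorOneForm E M) (z : M) (u : TangentSpace 𝓘(ℝ, E) z) :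
    u ∈ nullity Γ z ↔ u ∈ horSpace Γ z ∧ curvature Γ z u = 0 :=
  Iff.rfl

/-- The nullity index `μ_R(z) = dim N_R(z)`. -/
def nullityIndex (Γ : VectorOneForm E M) (z : M) : ℕ :=
  Module.finrank ℝ (nullity Γ z)

end Forms

/-- A field `D` of tangent subspaces is completely integrable on `U` if every point of `U` lies
in the domain, contained in `U`, of a smooth chart `φ` of `M` that is flat for `D`: at every
point `z` of the domain, `D z` is the subspace of `T_z M` that `dφ_z` identifies with one fixed
subspace `F` of the model space. After a linear change of the coordinates `φ`, this says that
`D` is spanned by the first `dim F` coordinate vector fields. -/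
def IsCompletelyIntegrableOn {E : Type*} [NormedAddCommGroup E] [NormedSpace ℝ E]
    {M : Type*} [TopologicalSpace M] [ChartedSpace E M]
    (D : (z : M) → Submodule ℝ (TangentSpace 𝓘(ℝ, E) z)) (U : Set M) : Prop :=
  ∀ p ∈ U, ∃ φ ∈ IsManifold.maximalAtlas 𝓘(ℝ, E) ∞ M, p ∈ φ.source ∧ φ.source ⊆ U ∧
    ∃ F : Submodule ℝ E, ∀ z ∈ φ.source, ∀ u : TangentSpace 𝓘(ℝ, E) z,
      u ∈ D z ↔ (mfderiv 𝓘(ℝ, E) 𝓘(ℝ, E) φ z u : E) ∈ F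

end LConn

end

/-
An `L`-connection satisfies `Γ² = I`, since `Γ X - X` lies in `Ker L = Im L`, where `Γ = -I`; so
`h` is a projector. For horizontal fields `X` and `Z` the curvature is `R(X, Z) = h[X, Z] - [X, Z]`,
so a horizontal `X` lies in the nullity of `R` exactly when `ad X` preserves the horizontal fields;
by the Jacobi identity such `X` are closed under brackets.

In a chart the nullity is the kernel of the smooth family of linear maps `X ↦ (X - h X, i_X R)`,
hence, where its dimension is constant, locally the field of graphs of a smooth family
`a(x, y)` of linear maps. Involutivity is then the integrability condition of the total
differential equation `dy = a(x, y) dx`. Its restriction to rays through the origin is solved,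
smoothly in all the data, by the implicit function theorem in the space of continuous curves; the
integrability condition makes these solutions solve the full equation, and they straighten the
field of graphs.
-/

open scoped Topology

namespace LConn

universe u v

section Postcomposition

variable {K : Type*} [TopologicalSpace K] [CompactSpace K]
  {E F : Type*} [NormedAddCommGroup E] [NormedSpace ℝ E]
  [NormedAddCommGroup F] [NormedSpace ℝ F]

/-- Pointwise application of a continuous family of continuous linear maps to a continuous
family of vectors. -/
noncomputable def pointwiseApply (K : Type*) [TopologicalSpace K] [CompactSpace K]
    (E F : Type*) [NormedAddCommGroup E] [NormedSpace ℝ E]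
    [NormedAddCommGroup F] [NormedSpace ℝ F] :
    C(K, E →L[ℝ] F) →L[ℝ] C(K, E) →L[ℝ] C(K, F) :=
  LinearMap.mkContinuous₂
    (LinearMap.mk₂ ℝ (fun (A : C(K, E →L[ℝ] F)) (g : C(K, E)) =>
        (⟨fun t => A t (g t), A.continuous.clm_apply g.continuous⟩ : C(K, F)))
      (fun _ _ _ => by ext; simp) (fun _ _ _ => by ext; simp)
      (fun _ _ _ => by ext; simp) (fun _ _ _ => by ext; simp))
    1 (fun A g => by
      rw [ContinuousMap.norm_le _ (by positivity)]
      intro t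
      rw [one_mul]
      exact (A t).le_of_opNorm_le_of_le (A.norm_coe_le_norm t) (g.norm_coe_le_norm t))

theorem hasFDerivAt_postcomp {f : C(E, F)} {f' : C(E, E →L[ℝ] F)}
    (hf : ∀ x, HasFDerivAt f (f' x) x) (g : C(K, E)) :
    HasFDerivAt (fun g : C(K, E) => f.comp g) (pointwiseApply K E F (f'.comp g)) g := by
  rw [hasFDerivAt_iff_isLittleO, Asymptotics.isLittleO_iff]
  intro ε hε
  obtain ⟨δ, hδ, hclose⟩ := (Metric.continuous_iff (α := C(K, E)) (β := C(K, E →L[ℝ] F))).1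
    (ContinuousMap.continuous_postcomp f') g ε hε
  -- Translating `g` by constants makes `δ` uniform in `t`.
  have hball : ∀ t, ∀ y ∈ Metric.ball (g t) δ, ‖f' y - f' (g t)‖ ≤ ε := by
    intro t y hy
    have hdist := hclose (g + ContinuousMap.const K (y - g t)) (by
      rw [dist_eq_norm, add_sub_cancel_left, ContinuousMap.norm_lt_iff _ hδ]
      intro s
      simpa [dist_eq_norm] using hy)
    simpa [dist_eq_norm] using (ContinuousMap.dist_apply_le_dist t).trans hdist.le
  filter_upwards [Metric.ball_mem_nhds g hδ] with g₁ hg₁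
  rw [ContinuousMap.norm_le _ (by positivity)]
  intro t
  have hg₁t : g₁ t ∈ Metric.ball (g t) δ := (ContinuousMap.dist_apply_le_dist t).trans_lt hg₁
  refine ((convex_ball (g t) δ).norm_image_sub_le_of_norm_hasFDerivWithin_le'
    (fun y _ => (hf y).hasFDerivWithinAt) (hball t) (Metric.mem_ball_self hδ) hg₁t).trans ?_
  gcongr
  exact (g₁ - g).norm_coe_le_norm t

-- The induction replaces `F` by `E →L[ℝ] F`, hence the common universe.
theorem contDiff_nat_postcomp {E : Type u} [NormedAddCommGroup E] [NormedSpace ℝ E] (n : ℕ) :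
    ∀ {F : Type u} [NormedAddCommGroup F] [NormedSpace ℝ F] (f : C(E, F)),
      ContDiff ℝ n f → ContDiff ℝ n (fun g : C(K, E) => f.comp g) := by
  induction n with
  | zero => exact fun f _ => contDiff_zero.2 (ContinuousMap.continuous_postcomp f)
  | succ n ih =>
    intro F _ _ f hf
    have hf' : ContDiff ℝ n (fderiv ℝ f) := hf.fderiv_right le_rfl
    let f' : C(E, E →L[ℝ] F) := ⟨fderiv ℝ f, hf'.continuous⟩
    refine contDiff_succ_iff_hasFDerivAt.2 ⟨fun g => pointwiseApply K E F (f'.comp g),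
      ContDiff.comp (g := pointwiseApply K E F) (by fun_prop) (ih f' hf'), fun g => ?_⟩
    exact hasFDerivAt_postcomp (f' := f')
      (fun x => (hf.differentiable (by simp) x).hasFDerivAt) g

theorem contDiff_postcomp {E : Type u} {F : Type v} [NormedAddCommGroup E] [NormedSpace ℝ E]
    [NormedAddCommGroup F] [NormedSpace ℝ F] {n : ℕ∞} (f : C(E, F)) (hf : ContDiff ℝ n f) :
    ContDiff ℝ n (fun g : C(K, E) => f.comp g) := by
  let iE : ULift.{v} E ≃L[ℝ] E := .ulift
  let iF : ULift.{u} F ≃L[ℝ] F := .ulift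
  let f' : C(ULift.{v} E, ULift.{u} F) := ⟨iF.symm ∘ f ∘ iE, by fun_prop⟩
  have hf' : ContDiff ℝ n f' := iF.symm.contDiff.comp (hf.comp iE.contDiff)
  have hpost : ContDiff ℝ n (fun g : C(K, ULift.{v} E) => f'.comp g) :=
    contDiff_iff_forall_nat_le.2 fun m hm =>
      contDiff_nat_postcomp m f' (hf'.of_le (by exact_mod_cast hm))
  exact ((iF : ULift.{u} F →L[ℝ] F).compLeftContinuous ℝ K).contDiff.comp
    (hpost.comp ((iE.symm : E →L[ℝ] ULift.{v} E).compLeftContinuous ℝ K).contDiff)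

end Postcomposition

section InverseFunction

variable {E F : Type*} [NormedAddCommGroup E] [NormedSpace ℝ E]
  [NormedAddCommGroup F] [NormedSpace ℝ F]

theorem exists_openPartialHomeomorph_contDiffOn_symm [CompleteSpace E] {f : E → F} {s : Set E}
    (hs : IsOpen s) (hf : ContDiffOn ℝ ∞ f s) {a : E} (ha : a ∈ s)
    (hf' : (fderiv ℝ f a).IsInvertible) :
    ∃ e : OpenPartialHomeomorph E F, a ∈ e.source ∧ e.source ⊆ s ∧ (e : E → F) = f ∧
      ContDiffOn ℝ ∞ e.symm e.target := by
  have hfs : ∀ x ∈ s, ContDiffAt ℝ ∞ f x := fun x hx => hf.contDiffAt (hs.mem_nhds hx)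
  have hderiv : ∀ x ∈ s, HasFDerivAt f (fderiv ℝ f x) x := fun x hx =>
    ((hfs x hx).differentiableAt (by simp)).hasFDerivAt
  obtain ⟨f', hf'⟩ := hf'
  have hfa : HasFDerivAt f (f' : E →L[ℝ] F) a := hf' ▸ hderiv a ha
  let e₀ := (hfs a ha).toOpenPartialHomeomorph f hfa (by simp)
  have hopen : IsOpen (s ∩ fderiv ℝ f ⁻¹' Set.range ((↑) : (E ≃L[ℝ] F) → E →L[ℝ] F)) :=
    (hf.continuousOn_fderiv_of_isOpen hs (by simp)).isOpen_inter_preimage hs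
      ContinuousLinearEquiv.isOpen
  refine ⟨e₀.restrOpen _ hopen,
    ⟨(hfs a ha).mem_toOpenPartialHomeomorph_source hfa (by simp), ha, f', hf'⟩,
    fun x hx => hx.2.1, rfl, fun y hy => ContDiffAt.contDiffWithinAt ?_⟩
  obtain ⟨-, hxs, B, hB⟩ := (e₀.restrOpen _ hopen).map_target hy
  exact (e₀.restrOpen _ hopen).contDiffAt_symm hy (hB ▸ hderiv _ hxs) (hfs _ hxs)

theorem isInvertible_fst_prod {A : E × F →L[ℝ] F}
    (hA : (A.comp (ContinuousLinearMap.inr ℝ E F)).IsInvertible) :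
    ((ContinuousLinearMap.fst ℝ E F).prod A).IsInvertible := by
  obtain ⟨B, hB⟩ := hA
  refine ⟨(ContinuousLinearEquiv.refl ℝ E).skewProd B
    (A.comp (ContinuousLinearMap.inl ℝ E F)), ?_⟩
  refine ContinuousLinearMap.ext fun v => Prod.ext (by simp) ?_
  have hv : B v.2 = A (0, v.2) := DFunLike.congr_fun hB v.2
  simp [hv, ← map_add]

theorem exists_openPartialHomeomorph_prodMk [CompleteSpace E] [CompleteSpace F] {f : E × F → F}
    {s : Set (E × F)} (hs : IsOpen s) (hf : ContDiffOn ℝ ∞ f s) {p : E × F} (hp : p ∈ s)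
    (hf' : (fderiv ℝ (fun y => f (p.1, y)) p.2).IsInvertible) :
    ∃ e : OpenPartialHomeomorph (E × F) (E × F), p ∈ e.source ∧ e.source ⊆ s ∧
      (e : E × F → E × F) = (fun q => (q.1, f q)) ∧ ContDiffOn ℝ ∞ e.symm e.target := by
  have hfp : HasFDerivAt f (fderiv ℝ f p) p :=
    ((hf.contDiffAt (hs.mem_nhds hp)).differentiableAt (by simp)).hasFDerivAt
  refine exists_openPartialHomeomorph_contDiffOn_symm hs (contDiffOn_fst.prodMk hf) hp ?_
  rw [(hasFDerivAt_fst.prodMk hfp).fderiv]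
  refine isInvertible_fst_prod ?_
  rwa [← (hfp.comp p.2 (hasFDerivAt_prodMk_right p.1 p.2)).fderiv]

end InverseFunction

section RayEquation

open scoped unitInterval

variable {E F : Type*} [NormedAddCommGroup E] [NormedSpace ℝ E]
  [NormedAddCommGroup F] [NormedSpace ℝ F]

/-- The primitive `t ↦ ∫₀ᵗ g` of a curve on the unit interval. The curve is extended to the real
line by constants, so that the primitive is differentiable at the end points too. -/
noncomputable def primitive (g : C(I, F)) (t : ℝ) : F :=
  ∫ s in (0 : ℝ)..t, Set.IccExtend zero_le_one g s

theorem hasDerivAt_primitive [CompleteSpace F] (g : C(I, F)) (t : ℝ) :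
    HasDerivAt (primitive g) (Set.IccExtend zero_le_one g t) t :=
  (g.continuous.Icc_extend'.integral_hasStrictDerivAt 0 t).hasDerivAt

/-- The operator sending a curve on the unit interval to its primitive vanishing at `0`. -/
noncomputable def primitiveCLM (F : Type*) [NormedAddCommGroup F] [NormedSpace ℝ F]
    [CompleteSpace F] : C(I, F) →L[ℝ] C(I, F) :=
  LinearMap.mkContinuous
    { toFun := fun g => ⟨fun t => primitive g t,
        (continuous_iff_continuousAt.2 fun t => (hasDerivAt_primitive g t).continuousAt).comp
          continuous_subtype_val⟩
      map_add' := fun g g' => ContinuousMap.ext fun _ =>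
        intervalIntegral.integral_add (g.continuous.Icc_extend'.intervalIntegrable _ _)
          (g'.continuous.Icc_extend'.intervalIntegrable _ _)
      map_smul' := fun c g => ContinuousMap.ext fun _ => intervalIntegral.integral_smul c _ }
    1 (fun g => by
      rw [ContinuousMap.norm_le _ (by positivity)]
      intro t
      refine (intervalIntegral.norm_integral_le_of_norm_le_const (C := ‖g‖)
        fun s _ => g.norm_coe_le_norm _).trans ?_
      rw [mul_comm]
      gcongr
      rw [sub_zero, abs_of_nonneg t.2.1]
      exact t.2.2)

/-- The curve `s ↦ (s x, x, γ s)`, as a function of `((x, y), γ)`. -/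
noncomputable def rayLift (E F : Type*) [NormedAddCommGroup E] [NormedSpace ℝ E]
    [NormedAddCommGroup F] [NormedSpace ℝ F] :
    ((E × F) × C(I, F)) →L[ℝ] C(I, E × E × F) :=
  LinearMap.mkContinuous
    { toFun := fun p => ⟨fun s => ((s : ℝ) • p.1.1, p.1.1, p.2 s), by fun_prop⟩
      map_add' := fun p p' => by ext s <;> simp
      map_smul' := fun c p => ContinuousMap.ext fun s => Prod.ext (smul_comm _ _ _) rfl }
    1 (fun p => by
      rw [ContinuousMap.norm_le _ (by positivity), one_mul]
      intro s
      have hx : ‖p.1.1‖ ≤ ‖p‖ := (norm_fst_le p.1).trans (norm_fst_le p)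
      have hγ : ‖p.2 s‖ ≤ ‖p‖ := (p.2.norm_coe_le_norm s).trans (norm_snd_le p)
      have hsx : ‖(s : ℝ) • p.1.1‖ ≤ ‖p‖ := by
        rw [norm_smul, Real.norm_of_nonneg s.2.1]
        exact (mul_le_of_le_one_left (norm_nonneg _) s.2.2).trans hx
      exact norm_prod_le_iff.2 ⟨hsx, norm_prod_le_iff.2 ⟨hx, hγ⟩⟩)

/-- The right-hand side `(u, x, y) ↦ a (u, y) x` of the total differential equation `dy = a dx`
restricted to rays. -/
noncomputable def rayRHS (a : C(E × F, E →L[ℝ] F)) : C(E × E × F, F) :=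
  ⟨fun p => a (p.1, p.2.2) p.2.1, by fun_prop⟩

theorem contDiff_rayRHS {n : ℕ∞} {a : C(E × F, E →L[ℝ] F)} (ha : ContDiff ℝ n a) :
    ContDiff ℝ n (rayRHS a) :=
  (ha.comp (contDiff_fst.prodMk contDiff_snd.snd)).clm_apply contDiff_snd.fst

theorem fderiv_rayRHS_apply {a : C(E × F, E →L[ℝ] F)} {p : E × E × F}
    (ha : DifferentiableAt ℝ a (p.1, p.2.2)) (q : E × E × F) :
    fderiv ℝ (rayRHS a) p q =
      fderiv ℝ a (p.1, p.2.2) (q.1, q.2.2) p.2.1 + a (p.1, p.2.2) q.2.1 := by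
  have hproj : HasFDerivAt (fun p : E × E × F => (p.1, p.2.2))
      ((ContinuousLinearMap.fst ℝ E (E × F)).prod
        ((ContinuousLinearMap.snd ℝ E F).comp (ContinuousLinearMap.snd ℝ E (E × F)))) p :=
    hasFDerivAt_fst.prodMk hasFDerivAt_snd.snd
  have hrhs : fderiv ℝ (rayRHS a) p = _ :=
    ((ha.hasFDerivAt.comp p hproj).clm_apply (hasFDerivAt_snd (p := p)).fst).fderiv
  rw [hrhs]
  simp [add_comm]

variable [CompleteSpace F]

/-- The difference of the two sides of the integral equation
`γ t = y + ∫₀ᵗ a (s x, γ s) x ds`, as a function of `((x, y), γ)`. A zero is a solution of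
`dy = a dx` along the ray through `x` with value `y` at the origin. -/
noncomputable def rayEquation (a : C(E × F, E →L[ℝ] F)) (p : (E × F) × C(I, F)) : C(I, F) :=
  p.2 - ContinuousLinearMap.const ℝ I p.1.2
    - primitiveCLM F ((rayRHS a).comp (rayLift E F p))

theorem contDiff_rayEquation {n : ℕ∞} {a : C(E × F, E →L[ℝ] F)} (ha : ContDiff ℝ n a) :
    ContDiff ℝ n (rayEquation a) := by
  have hrhs : ContDiff ℝ n (fun p : (E × F) × C(I, F) => (rayRHS a).comp (rayLift E F p)) :=
    (contDiff_postcomp (rayRHS a) (contDiff_rayRHS ha)).comp (rayLift E F).contDiff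
  have hconst : ContDiff ℝ n (fun p : (E × F) × C(I, F) =>
      ContinuousLinearMap.const ℝ I p.1.2) :=
    ContDiff.comp (g := ContinuousLinearMap.const ℝ I (M := F))
      (ContinuousLinearMap.contDiff _) contDiff_fst.snd
  exact (contDiff_snd.sub hconst).sub ((primitiveCLM F).contDiff.comp hrhs)

theorem rayEquation_zero_left (a : C(E × F, E →L[ℝ] F)) (y : F) (γ : C(I, F)) :
    rayEquation a ((0, y), γ) = γ - ContinuousLinearMap.const ℝ I y := by
  have h : (rayRHS a).comp (rayLift E F ((0, y), γ)) = 0 :=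
    ContinuousMap.ext fun s => map_zero (a ((s : ℝ) • (0 : E), γ s))
  rw [rayEquation, h, map_zero, sub_zero]

theorem exists_contDiffOn_rayEquation_eq_zero [CompleteSpace E]
    {a : C(E × F, E →L[ℝ] F)} (ha : ContDiff ℝ ∞ a) :
    ∃ (V : Set (E × F)) (Y : E × F → C(I, F)), IsOpen V ∧ (0, 0) ∈ V ∧
      ContDiffOn ℝ ∞ Y V ∧ ∀ q ∈ V, rayEquation a (q, Y q) = 0 := by
  have hinv : (fderiv ℝ (fun γ => rayEquation a (((0 : E), (0 : F)), γ)) 0).IsInvertible := by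
    simp only [rayEquation_zero_left, map_zero, sub_zero, fderiv_fun_id]
    exact ⟨ContinuousLinearEquiv.refl ℝ _, rfl⟩
  obtain ⟨e, hbase, -, he, hesymm⟩ := exists_openPartialHomeomorph_prodMk isOpen_univ
    (contDiff_rayEquation ha).contDiffOn (p := ((0, 0), 0)) (Set.mem_univ _) hinv
  have hmem : (((0 : E), (0 : F)), (0 : C(I, F))) ∈ e.target := by
    simpa only [he, rayEquation_zero_left, map_zero, sub_zero] using e.map_source hbase
  have hsymm : ∀ q, (q, (0 : C(I, F))) ∈ e.target →
      (e.symm (q, 0)).1 = q ∧ rayEquation a (e.symm (q, 0)) = 0 := fun q hq => by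
    simpa only [he, Prod.mk.injEq] using e.right_inv hq
  refine ⟨(fun q => (q, 0)) ⁻¹' e.target, fun q => (e.symm (q, 0)).2,
    e.open_target.preimage (by fun_prop), hmem, ?_, fun q hq => ?_⟩
  · exact contDiff_snd.comp_contDiffOn
      (hesymm.comp (contDiff_id.prodMk contDiff_const).contDiffOn fun q hq => hq)
  · obtain ⟨hfst, hzero⟩ := hsymm q hq
    rwa [show (q, (e.symm (q, 0)).2) = e.symm (q, 0) from Prod.ext hfst.symm rfl]

end RayEquation

section TotalDifferentialEquation

open scoped unitInterval
open Set (Icc)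

theorem eq_zero_of_hasDerivAt_clm_apply {F : Type*} [NormedAddCommGroup F] [NormedSpace ℝ F]
    {B : ℝ → F →L[ℝ] F} {w : ℝ → F} {b c : ℝ} (hB : ContinuousOn B (Icc b c))
    (hw : ∀ t ∈ Icc b c, HasDerivAt w (B t (w t)) t) (hb : w b = 0) :
    ∀ t ∈ Icc b c, w t = 0 := by
  obtain ⟨C, hC⟩ := isCompact_Icc.exists_bound_of_continuousOn hB
  exact eq_zero_of_abs_deriv_le_mul_abs_self_of_eq_zero_right (K := C)
    (fun t ht => (hw t ht).continuousAt.continuousWithinAt)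
    (fun t ht => (hw t (Set.Ico_subset_Icc_self ht)).hasDerivWithinAt) hb
    fun t ht => (B t).le_of_opNorm_le (hC t (Set.Ico_subset_Icc_self ht)) _

variable {E F : Type*} [NormedAddCommGroup E] [NormedSpace ℝ E]
  [NormedAddCommGroup F] [NormedSpace ℝ F]

/-- The integrability condition for the total differential equation `dy = a(x, y) dx` on `W`: the
second derivatives `d(a dx)` that the equation prescribes for a solution are symmetric. -/
def TotallyIntegrableOn (a : E × F → E →L[ℝ] F) (W : Set (E × F)) : Prop :=
  ∀ p ∈ W, ∀ v w : E, fderiv ℝ a p (v, a p v) w = fderiv ℝ a p (w, a p w) v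

theorem TotallyIntegrableOn.hasDerivAt_variation_sub {a : E × F → E →L[ℝ] F} {W : Set (E × F)}
    (hint : TotallyIntegrableOn a W) {x v : E} {Z P : ℝ → F} {t : ℝ}
    (ha : DifferentiableAt ℝ a (t • x, Z t)) (hW : (t • x, Z t) ∈ W)
    (hZ : HasDerivAt Z (a (t • x, Z t) x) t)
    (hP : HasDerivAt P (fderiv ℝ a (t • x, Z t) (t • v, P t) x + a (t • x, Z t) v) t) :
    HasDerivAt (fun t => P t - t • a (t • x, Z t) v)
      (fderiv ℝ a (t • x, Z t) (0, P t - t • a (t • x, Z t) v) x) t := by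
  have hray : HasDerivAt (fun t => (t • x, Z t)) (x, a (t • x, Z t) x) t := by
    simpa using ((hasDerivAt_id t).smul_const x).prodMk hZ
  have hav : HasDerivAt (fun t => a (t • x, Z t) v)
      (fderiv ℝ a (t • x, Z t) (x, a (t • x, Z t) x) v) t :=
    (ContinuousLinearMap.apply ℝ F v).hasFDerivAt.comp_hasDerivAt t
      (HasFDerivAt.comp_hasDerivAt (l := a) t ha.hasFDerivAt hray)
  refine HasDerivAt.congr_deriv (f := fun t => P t - t • a (t • x, Z t) v)
    (hP.sub ((hasDerivAt_id t).smul hav)) ?_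
  have hsplit : ((0 : E), P t - t • a (t • x, Z t) v) =
      (t • v, P t) - t • (v, a (t • x, Z t) v) := by simp
  rw [hsplit, map_sub, map_smul, sub_apply, smul_apply, hint _ hW v x, id, one_smul]
  abel

theorem TotallyIntegrableOn.variation_eq {a : E × F → E →L[ℝ] F} {W : Set (E × F)}
    (hint : TotallyIntegrableOn a W) (ha : ContDiff ℝ 1 a) {x v : E} {Z P : ℝ → F}
    (hW : ∀ t ∈ Icc (0 : ℝ) 1, (t • x, Z t) ∈ W)
    (hZ : ∀ t ∈ Icc (0 : ℝ) 1, HasDerivAt Z (a (t • x, Z t) x) t)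
    (hP : ∀ t ∈ Icc (0 : ℝ) 1,
      HasDerivAt P (fderiv ℝ a (t • x, Z t) (t • v, P t) x + a (t • x, Z t) v) t)
    (hP0 : P 0 = 0) : P 1 = a (x, Z 1) v := by
  have hcont : ContinuousOn (fun t : ℝ => fderiv ℝ a (t • x, Z t)) (Icc 0 1) :=
    (ha.continuous_fderiv (by simp)).comp_continuousOn
      ((by fun_prop : Continuous fun t : ℝ => t • x).continuousOn.prodMk
        fun t ht => (hZ t ht).continuousAt.continuousWithinAt)
  have hlinear := eq_zero_of_hasDerivAt_clm_apply
    (B := fun t => (ContinuousLinearMap.apply ℝ F x).comp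
      ((fderiv ℝ a (t • x, Z t)).comp (ContinuousLinearMap.inr ℝ E F)))
    (w := fun t => P t - t • a (t • x, Z t) v)
    (by fun_prop)
    (fun t ht => hint.hasDerivAt_variation_sub (ha.differentiable (by simp) _) (hW t ht)
      (hZ t ht) (hP t ht))
    (by simp [hP0])
  simpa [sub_eq_zero] using hlinear 1 (by simp)

end TotalDifferentialEquation

section RaySolutions

open scoped unitInterval
open Set (Icc)

variable {E F : Type*} [NormedAddCommGroup E] [NormedSpace ℝ E]
  [NormedAddCommGroup F] [NormedSpace ℝ F] [CompleteSpace F]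
  {a : C(E × F, E →L[ℝ] F)} {Y : E × F → C(I, F)} {q : E × F}

theorem exists_fderiv_eq_primitiveCLM (ha : ContDiff ℝ 1 a) (hY : DifferentiableAt ℝ Y q)
    (hq : ∀ᶠ q' in 𝓝 q, rayEquation a (q', Y q') = 0) (v : E) :
    ∃ g : C(I, F), fderiv ℝ Y q (v, 0) = primitiveCLM F g ∧ ∀ t : I, g t =
      fderiv ℝ a ((t : ℝ) • q.1, Y q t) ((t : ℝ) • v, fderiv ℝ Y q (v, 0) t) q.1 +
        a ((t : ℝ) • q.1, Y q t) v := by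
  have hrhs : ContDiff ℝ 1 (rayRHS a) := contDiff_rayRHS ha
  let rhs' : C(E × E × F, (E × E × F) →L[ℝ] F) :=
    ⟨fderiv ℝ (rayRHS a), hrhs.continuous_fderiv (by simp)⟩
  let A := pointwiseApply I _ F (rhs'.comp (rayLift E F (q, Y q)))
  refine ⟨A (rayLift E F ((v, 0), fderiv ℝ Y q (v, 0))), ?_,
    fun t => fderiv_rayRHS_apply (ha.differentiable (by simp) _) _⟩
  have hlift : HasFDerivAt (fun q => rayLift E F (q, Y q)) ((rayLift E F).comp
      ((ContinuousLinearMap.id ℝ (E × F)).prod (fderiv ℝ Y q))) q :=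
    (rayLift E F).hasFDerivAt.comp q ((hasFDerivAt_id _).prodMk hY.hasFDerivAt)
  have hpost : HasFDerivAt (fun c : C(I, E × E × F) => (rayRHS a).comp c) A
      (rayLift E F (q, Y q)) :=
    hasFDerivAt_postcomp (f' := rhs')
      (fun p => (hrhs.differentiable (by simp) p).hasFDerivAt) _
  have hcomp := HasFDerivAt.comp q hpost hlift
  have hconst : HasFDerivAt (fun q : E × F =>
      (ContinuousLinearMap.const ℝ I : F →L[ℝ] C(I, F)) q.2) _ q :=
    (ContinuousLinearMap.const ℝ I : F →L[ℝ] C(I, F)).hasFDerivAt.comp q hasFDerivAt_snd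
  have heq : HasFDerivAt (fun q => rayEquation a (q, Y q)) _ q :=
    (hY.hasFDerivAt.sub hconst).sub
      ((primitiveCLM F).hasFDerivAt.comp q hcomp)
  have hzero : HasFDerivAt (fun q => rayEquation a (q, Y q)) (0 : E × F →L[ℝ] C(I, F)) q :=
    (hasFDerivAt_const (0 : C(I, F)) q).congr_of_eventuallyEq hq
  have happly : fderiv ℝ Y q (v, 0) - ContinuousLinearMap.const ℝ I (0 : F) -
      primitiveCLM F (A (rayLift E F ((v, 0), fderiv ℝ Y q (v, 0)))) = 0 :=
    DFunLike.congr_fun (heq.unique hzero) (v, 0)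
  rwa [map_zero, sub_zero, sub_eq_zero] at happly

theorem TotallyIntegrableOn.fderiv_solution_apply {W : Set (E × F)}
    (hint : TotallyIntegrableOn a W) (ha : ContDiff ℝ 1 a) (hY : DifferentiableAt ℝ Y q)
    (hq : ∀ᶠ q' in 𝓝 q, rayEquation a (q', Y q') = 0)
    (hW : ∀ t : I, ((t : ℝ) • q.1, Y q t) ∈ W) (v : E) :
    fderiv ℝ Y q (v, 0) 1 = a (q.1, Y q 1) v := by
  obtain ⟨g, hYg, hg⟩ := exists_fderiv_eq_primitiveCLM ha hY hq v
  let k : C(I, F) := (rayRHS a).comp (rayLift E F (q, Y q))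
  have hYk : Y q = ContinuousLinearMap.const ℝ I q.2 + primitiveCLM F k := by
    rw [← sub_eq_zero, ← sub_sub]
    exact hq.self_of_nhds
  have hZ : ∀ t ∈ Icc (0 : ℝ) 1, Set.IccExtend zero_le_one (Y q) t = q.2 + primitive k t :=
    fun t ht => by
      rw [Set.IccExtend_of_mem _ _ ht]
      exact DFunLike.congr_fun hYk ⟨t, ht⟩
  have hP : ∀ t ∈ Icc (0 : ℝ) 1,
      Set.IccExtend zero_le_one (fderiv ℝ Y q (v, 0)) t = primitive g t := fun t ht => by
    rw [Set.IccExtend_of_mem _ _ ht]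
    exact DFunLike.congr_fun hYg ⟨t, ht⟩
  have hend := hint.variation_eq (x := q.1) (v := v) (Z := fun t => q.2 + primitive k t)
    (P := primitive g) ha
    (fun t ht => by
      rw [← hZ t ht, Set.IccExtend_of_mem _ _ ht]
      exact hW ⟨t, ht⟩)
    (fun t ht => by
      convert (hasDerivAt_primitive k t).const_add q.2 using 1
      rw [← hZ t ht, Set.IccExtend_of_mem _ _ ht, Set.IccExtend_of_mem _ _ ht]
      rfl)
    (fun t ht => by
      convert hasDerivAt_primitive g t using 1
      rw [← hZ t ht, ← hP t ht, Set.IccExtend_of_mem _ _ ht, Set.IccExtend_of_mem _ _ ht,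
        Set.IccExtend_of_mem _ _ ht]
      exact (hg ⟨t, ht⟩).symm)
    intervalIntegral.integral_same
  have h1 : (1 : ℝ) ∈ Icc (0 : ℝ) 1 := by simp
  rw [← hP 1 h1, ← hZ 1 h1, Set.IccExtend_of_mem _ _ h1, Set.IccExtend_of_mem _ _ h1] at hend
  exact hend

theorem TotallyIntegrableOn.exists_solution [CompleteSpace E] {W : Set (E × F)}
    (hint : TotallyIntegrableOn a W) (ha : ContDiff ℝ ∞ a) (hW : IsOpen W) (hW0 : (0, 0) ∈ W) :
    ∃ (φ : E × F → F) (S : Set (E × F)), IsOpen S ∧ (0, 0) ∈ S ∧ ContDiffOn ℝ ∞ φ S ∧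
      (∀ᶠ y in 𝓝 0, φ (0, y) = y) ∧
      ∀ q ∈ S, (q.1, φ q) ∈ W ∧ ∀ v, fderiv ℝ φ q (v, 0) = a (q.1, φ q) v := by
  obtain ⟨V, Y, hV, hV0, hY, hYeq⟩ := exists_contDiffOn_rayEquation_eq_zero ha
  have hYzero : ∀ y, (0, y) ∈ V → Y (0, y) = ContinuousLinearMap.const ℝ I y := fun y hy => by
    rw [← sub_eq_zero, ← rayEquation_zero_left a, hYeq _ hy]
  let S : Set (E × F) := V ∩ (fun q => rayLift E F (q, Y q)) ⁻¹'
    {g | Set.MapsTo g Set.univ {p | (p.1, p.2.2) ∈ W}}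
  have hS : IsOpen S := by
    refine ContinuousOn.isOpen_inter_preimage ?_ hV
      (ContinuousMap.isOpen_setOfPred_mapsTo isCompact_univ (hW.preimage (by fun_prop)))
    exact (rayLift E F).continuous.comp_continuousOn (continuousOn_id.prodMk hY.continuousOn)
  have hYW : ∀ q ∈ S, ∀ t : I, ((t : ℝ) • q.1, Y q t) ∈ W := fun q hq t => hq.2 (Set.mem_univ t)
  let ev : C(I, F) →L[ℝ] F := ContinuousMap.evalCLM ℝ 1
  refine ⟨fun q => ev (Y q), S, hS, ⟨hV0, fun t _ => ?_⟩,
    ev.contDiff.comp_contDiffOn (hY.mono Set.inter_subset_left), ?_, fun q hq => ⟨?_, fun v => ?_⟩⟩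
  · change ((t : ℝ) • (0 : E), Y (0, 0) t) ∈ W
    simpa [hYzero 0 hV0] using hW0
  · have hc : ContinuousAt (fun y : F => ((0 : E), y)) 0 := by fun_prop
    filter_upwards [hc.preimage_mem_nhds (hV.mem_nhds hV0)] with y hy
    rw [hYzero y hy]
    rfl
  · simpa [ev] using hYW q hq 1
  · have hYd : DifferentiableAt ℝ Y q :=
      (hY.contDiffAt (hV.mem_nhds hq.1)).differentiableAt (by simp)
    have hev : fderiv ℝ (fun q => ev (Y q)) q = ev.comp (fderiv ℝ Y q) :=
      (ev.hasFDerivAt.comp q hYd.hasFDerivAt).fderiv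
    rw [hev]
    exact hint.fderiv_solution_apply (ha.of_le (by simp)) hYd
      (Filter.eventually_of_mem (hV.mem_nhds hq.1) hYeq) (hYW q hq) v

end RaySolutions

section MapsDistribution

variable {E E' E'' : Type*} [NormedAddCommGroup E] [NormedSpace ℝ E]
  [NormedAddCommGroup E'] [NormedSpace ℝ E'] [NormedAddCommGroup E''] [NormedSpace ℝ E'']
  {M M' M'' : Type*} [TopologicalSpace M] [ChartedSpace E M]
  [TopologicalSpace M'] [ChartedSpace E' M'] [TopologicalSpace M''] [ChartedSpace E'' M'']
  {e : OpenPartialHomeomorph M M'} {e' : OpenPartialHomeomorph M' M''}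
  {D : (z : M) → Submodule ℝ (TangentSpace 𝓘(ℝ, E) z)}
  {D' : (z : M') → Submodule ℝ (TangentSpace 𝓘(ℝ, E') z)}
  {D'' : (z : M'') → Submodule ℝ (TangentSpace 𝓘(ℝ, E'') z)}

/-- The partial diffeomorphism `e` identifies the field of tangent subspaces `D`, restricted to
its source, with the field `D'`, restricted to its target. -/
structure MapsDistribution (e : OpenPartialHomeomorph M M')
    (D : (z : M) → Submodule ℝ (TangentSpace 𝓘(ℝ, E) z))
    (D' : (z : M') → Submodule ℝ (TangentSpace 𝓘(ℝ, E') z)) : Prop where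
  contMDiffOn : ContMDiffOn 𝓘(ℝ, E) 𝓘(ℝ, E') ∞ e e.source
  contMDiffOn_symm : ContMDiffOn 𝓘(ℝ, E') 𝓘(ℝ, E) ∞ e.symm e.target
  mem_iff : ∀ z ∈ e.source, ∀ u : TangentSpace 𝓘(ℝ, E) z,
    u ∈ D z ↔ mfderiv 𝓘(ℝ, E) 𝓘(ℝ, E') e z u ∈ D' (e z)

namespace MapsDistribution

theorem mdifferentiable (h : MapsDistribution e D D') :
    e.MDifferentiable 𝓘(ℝ, E) 𝓘(ℝ, E') :=
  ⟨h.contMDiffOn.mdifferentiableOn (by simp), h.contMDiffOn_symm.mdifferentiableOn (by simp)⟩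

theorem contMDiffAt (h : MapsDistribution e D D') {z : M} (hz : z ∈ e.source) :
    ContMDiffAt 𝓘(ℝ, E) 𝓘(ℝ, E') ∞ e z :=
  (h.contMDiffOn z hz).contMDiffAt (e.open_source.mem_nhds hz)

theorem contMDiffAt_symm (h : MapsDistribution e D D') {z : M'} (hz : z ∈ e.target) :
    ContMDiffAt 𝓘(ℝ, E') 𝓘(ℝ, E) ∞ e.symm z :=
  (h.contMDiffOn_symm z hz).contMDiffAt (e.open_target.mem_nhds hz)

theorem isInvertible_mfderiv (h : MapsDistribution e D D') {z : M} (hz : z ∈ e.source) :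
    (mfderiv 𝓘(ℝ, E) 𝓘(ℝ, E') e z).IsInvertible :=
  ⟨h.mdifferentiable.mfderiv hz, rfl⟩

theorem finrank_eq (h : MapsDistribution e D D') {z : M} (hz : z ∈ e.source) :
    Module.finrank ℝ (D z) = Module.finrank ℝ (D' (e z)) := by
  let B := (h.mdifferentiable.mfderiv hz).toLinearEquiv
  have hmap : D' (e z) = (D z).map (B : TangentSpace 𝓘(ℝ, E) z →ₗ[ℝ] _) := by
    ext v
    obtain ⟨u, rfl⟩ := B.surjective v
    refine (h.mem_iff z hz u).symm.trans ⟨fun hu => ⟨u, hu, rfl⟩, ?_⟩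
    rintro ⟨u', hu', huu'⟩
    rwa [← B.injective huu']
  rw [hmap, B.finrank_map_eq]

theorem symm (h : MapsDistribution e D D') : MapsDistribution e.symm D' D where
  contMDiffOn := h.contMDiffOn_symm
  contMDiffOn_symm := by simpa using h.contMDiffOn
  mem_iff z hz u := by
    have hmem : ∀ y, y = z → ∀ v : E', @Membership.mem E' (Submodule ℝ E') _ (D' y) v ↔
        @Membership.mem E' (Submodule ℝ E') _ (D' z) v := by rintro _ rfl _; rfl
    have hu : mfderiv 𝓘(ℝ, E) 𝓘(ℝ, E') e (e.symm z)
        (mfderiv 𝓘(ℝ, E') 𝓘(ℝ, E) e.symm z u) = u :=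
      DFunLike.congr_fun (h.mdifferentiable.comp_symm_deriv hz) u
    rw [h.mem_iff _ (e.map_target hz), hu]
    exact (hmem _ (e.right_inv hz) u).symm

theorem trans (h : MapsDistribution e D D') (h' : MapsDistribution e' D' D'') :
    MapsDistribution (e ≫ₕ e') D D'' where
  contMDiffOn z hz :=
    ((h'.contMDiffAt hz.2).comp z (h.contMDiffAt hz.1)).contMDiffWithinAt
  contMDiffOn_symm z hz :=
    ((h.contMDiffAt_symm hz.2).comp z (h'.contMDiffAt_symm hz.1)).contMDiffWithinAt
  mem_iff z hz u := by
    have hez : e z ∈ e'.source := hz.2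
    have hcomp : mfderiv 𝓘(ℝ, E) 𝓘(ℝ, E'') (e' ∘ e) z = _ :=
      mfderiv_comp z (h'.mdifferentiable.mdifferentiableAt hez)
        (h.mdifferentiable.mdifferentiableAt hz.1)
    rw [h.mem_iff z hz.1, h'.mem_iff (e z) hez, OpenPartialHomeomorph.coe_trans, hcomp]
    rfl

end MapsDistribution

theorem isCompletelyIntegrableOn_iff_mapsDistribution [IsManifold 𝓘(ℝ, E) ∞ M] {U : Set M} :
    IsCompletelyIntegrableOn D U ↔ ∀ p ∈ U, ∃ (e : OpenPartialHomeomorph M E)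
      (F : Submodule ℝ E), p ∈ e.source ∧ e.source ⊆ U ∧ MapsDistribution e D fun _ => F := by
  refine forall₂_congr fun p _ => ⟨?_, ?_⟩
  · rintro ⟨φ, hφ, hp, hφU, F, hF⟩
    exact ⟨φ, F, hp, hφU, contMDiffOn_of_mem_maximalAtlas hφ,
      contMDiffOn_symm_of_mem_maximalAtlas hφ, hF⟩
  · rintro ⟨e, F, hp, heU, he⟩
    exact ⟨e, e.mem_maximalAtlas_of_contMDiffOn he.contMDiffOn he.contMDiffOn_symm, hp, heU, F,
      he.mem_iff⟩

theorem IsCompletelyIntegrableOn.of_mapsDistribution [IsManifold 𝓘(ℝ, E) ∞ M] {U : Set M}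
    (h : ∀ p ∈ U, ∃ e : OpenPartialHomeomorph M E, p ∈ e.source ∧ e.source ⊆ U ∧
      ∃ D' : (x : E) → Submodule ℝ (TangentSpace 𝓘(ℝ, E) x), MapsDistribution e D D' ∧
        IsCompletelyIntegrableOn D' e.target) :
    IsCompletelyIntegrableOn D U := by
  rw [isCompletelyIntegrableOn_iff_mapsDistribution]
  intro p hp
  obtain ⟨e, hpe, heU, D', he, hD'⟩ := h p hp
  obtain ⟨e', F, hpe', -, he'⟩ :=
    isCompletelyIntegrableOn_iff_mapsDistribution.1 hD' (e p) (e.map_source hpe)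
  exact ⟨e ≫ₕ e', F, ⟨hpe, hpe'⟩, fun z hz => heU hz.1, he.trans he'⟩

end MapsDistribution

section VectorSpace

variable {E E' : Type*} [NormedAddCommGroup E] [NormedSpace ℝ E]
  [NormedAddCommGroup E'] [NormedSpace ℝ E']

theorem MapsDistribution.of_contDiffOn {e : OpenPartialHomeomorph E E'} {D : E → Submodule ℝ E}
    {D' : E' → Submodule ℝ E'} (he : ContDiffOn ℝ ∞ e e.source)
    (he' : ContDiffOn ℝ ∞ e.symm e.target)
    (h : ∀ z ∈ e.source, ∀ u, u ∈ D z ↔ fderiv ℝ e z u ∈ D' (e z)) :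
    MapsDistribution e D D' where
  contMDiffOn := he.contMDiffOn
  contMDiffOn_symm := he'.contMDiffOn
  mem_iff z hz u := by
    rw [mfderiv_eq_fderiv]
    exact h z hz u

end VectorSpace

section Straightening

variable {E F : Type*} [NormedAddCommGroup E] [NormedSpace ℝ E]
  [NormedAddCommGroup F] [NormedSpace ℝ F]

theorem mapsDistribution_graph_of_fderiv_eq {φ : E × F → F}
    {e : OpenPartialHomeomorph (E × F) (E × F)} (he : ∀ q, e q = (q.1, φ q))
    (hφ : ContDiffOn ℝ ∞ φ e.source) (he' : ContDiffOn ℝ ∞ e.symm e.target)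
    {a : E × F → E →L[ℝ] F}
    (ha : ∀ q ∈ e.source, ∀ v, fderiv ℝ φ q (v, 0) = a (q.1, φ q) v) :
    MapsDistribution e (fun _ : E × F => (⊤ : Submodule ℝ E).prod (⊥ : Submodule ℝ F))
      fun z : E × F => (a z).toLinearMap.graph := by
  have hes : ContDiffOn ℝ ∞ e e.source := (contDiffOn_fst.prodMk hφ).congr fun q _ => he q
  refine .of_contDiffOn hes he' fun q hq u => ?_
  have hφq : HasFDerivAt φ (fderiv ℝ φ q) q :=
    ((hφ.contDiffAt (e.open_source.mem_nhds hq)).differentiableAt (by simp)).hasFDerivAt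
  have hderiv (u : E × F) : fderiv ℝ e q u = (u.1, fderiv ℝ φ q u) := by
    rw [funext he, (hasFDerivAt_fst.prodMk hφq).fderiv]
    rfl
  have hinj : Function.Injective (fderiv ℝ e q) := by
    rw [← mfderiv_eq_fderiv]
    exact OpenPartialHomeomorph.MDifferentiable.mfderiv_injective
      ⟨hes.contMDiffOn.mdifferentiableOn (by simp), he'.contMDiffOn.mdifferentiableOn (by simp)⟩ hq
  have hsplit : fderiv ℝ φ q u = a (q.1, φ q) u.1 + fderiv ℝ φ q (0, u.2) := by
    rw [← ha q hq, ← map_add]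
    simp
  have hvert : fderiv ℝ φ q (0, u.2) = 0 ↔ u.2 = 0 := by
    simpa [hderiv, Prod.ext_iff] using hinj.eq_iff (a := (0, u.2)) (b := 0)
  rw [hderiv, he, LinearMap.mem_graph_iff, Submodule.mem_prod, hsplit]
  simp [hvert]

variable [CompleteSpace E] [CompleteSpace F] {a : C(E × F, E →L[ℝ] F)}
  {W : Set (E × F)}

theorem TotallyIntegrableOn.exists_mapsDistribution
    (hint : TotallyIntegrableOn a W) (ha : ContDiff ℝ ∞ a) (hW : IsOpen W) (hW0 : (0, 0) ∈ W) :
    ∃ e : OpenPartialHomeomorph (E × F) (E × F), (0, 0) ∈ e.source ∧ e.source ⊆ W ∧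
      MapsDistribution e (fun z : E × F => (a z).toLinearMap.graph)
        fun _ : E × F => (⊤ : Submodule ℝ E).prod (⊥ : Submodule ℝ F) := by
  obtain ⟨φ, S, hS, hS0, hφ, hφ0, hφS⟩ := hint.exists_solution ha hW hW0
  have hid : fderiv ℝ (fun y => φ (0, y)) 0 = ContinuousLinearMap.id ℝ F :=
    (Filter.EventuallyEq.fderiv_eq hφ0).trans fderiv_id
  obtain ⟨e, he0, heS, he, he'⟩ := exists_openPartialHomeomorph_prodMk hS hφ hS0
    ⟨ContinuousLinearEquiv.refl ℝ F, hid.symm⟩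
  have happ (q : E × F) : e q = (q.1, φ q) := congrFun he q
  have h00 : e (0, 0) = (0, 0) := by rw [happ, hφ0.self_of_nhds]
  refine ⟨e.symm, h00 ▸ e.map_source he0, fun z hz => ?_,
    (mapsDistribution_graph_of_fderiv_eq happ (hφ.mono heS) he'
      fun q hq => (hφS q (heS hq)).2).symm⟩
  rw [← e.right_inv hz, happ]
  exact (hφS _ (heS (e.map_target hz))).1

end Straightening

section Involutivity

open VectorField

theorem minSmoothness_le_infty {n : WithTop ℕ∞} [ENat.LEInfty n] : minSmoothness ℝ n ≤ ∞ := by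
  rw [minSmoothness_of_isRCLikeNormedField]
  exact ENat.LEInfty.out

theorem mlieBracket_eq_lieBracket {E : Type*} [NormedAddCommGroup E] [NormedSpace ℝ E]
    (X Y : (z : E) → TangentSpace 𝓘(ℝ, E) z) :
    mlieBracket 𝓘(ℝ, E) X Y = lieBracket ℝ X Y := by
  rw [← mlieBracketWithin_univ, mlieBracketWithin_eq_lieBracketWithin]
  exact lieBracketWithin_univ

variable {E E' : Type*} [NormedAddCommGroup E] [NormedSpace ℝ E]
  [NormedAddCommGroup E'] [NormedSpace ℝ E']
  {M M' : Type*} [TopologicalSpace M] [ChartedSpace E M] [TopologicalSpace M'] [ChartedSpace E' M']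

/-- Involutivity of the field of tangent subspaces `D` at the point `z`: the bracket at `z` of two
smooth vector fields that are tangent to `D` near `z` lies in `D z`. -/
def IsInvolutiveAt [IsManifold 𝓘(ℝ, E) ∞ M]
    (D : (z : M) → Submodule ℝ (TangentSpace 𝓘(ℝ, E) z)) (z : M) : Prop :=
  ∀ X Y : (z : M) → TangentSpace 𝓘(ℝ, E) z, CMDiffAt ∞ (T% X) z → CMDiffAt ∞ (T% Y) z →
    (∀ᶠ y in 𝓝 z, X y ∈ D y) → (∀ᶠ y in 𝓝 z, Y y ∈ D y) → mlieBracket 𝓘(ℝ, E) X Y z ∈ D z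

variable {e : OpenPartialHomeomorph M M'}
  {D : (z : M) → Submodule ℝ (TangentSpace 𝓘(ℝ, E) z)}
  {D' : (z : M') → Submodule ℝ (TangentSpace 𝓘(ℝ, E') z)}

theorem MapsDistribution.mpullback_mem_iff (h : MapsDistribution e D D') {z : M}
    (hz : z ∈ e.source) (X : (z : M') → TangentSpace 𝓘(ℝ, E') z) :
    mpullback 𝓘(ℝ, E) 𝓘(ℝ, E') e X z ∈ D z ↔ X (e z) ∈ D' (e z) := by
  rw [h.mem_iff z hz, mpullback_apply]
  obtain ⟨B, hB⟩ := h.isInvertible_mfderiv hz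
  rw [← hB]
  simp

variable [CompleteSpace E] [IsManifold 𝓘(ℝ, E) ∞ M] [IsManifold 𝓘(ℝ, E') ∞ M']

theorem MapsDistribution.isInvolutiveAt (h : MapsDistribution e D D') {z : M} (hz : z ∈ e.source)
    (hD : IsInvolutiveAt D z) : IsInvolutiveAt D' (e z) := by
  intro X Y hX hY hXD hYD
  have : IsManifold 𝓘(ℝ, E) (minSmoothness ℝ 2) M := .of_le minSmoothness_le_infty
  have : IsManifold 𝓘(ℝ, E') (minSmoothness ℝ 2) M' := .of_le minSmoothness_le_infty
  have he := h.contMDiffAt hz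
  have hsmooth {V : (z : M') → TangentSpace 𝓘(ℝ, E') z} (hV : CMDiffAt ∞ (T% V) (e z)) :
      CMDiffAt ∞ (T% (mpullback 𝓘(ℝ, E) 𝓘(ℝ, E') e V)) z :=
    hV.mpullback_vectorField_preimage he (h.isInvertible_mfderiv hz) (by simp)
  have htangent {V : (z : M') → TangentSpace 𝓘(ℝ, E') z} (hV : ∀ᶠ y in 𝓝 (e z), V y ∈ D' y) :
      ∀ᶠ y in 𝓝 z, mpullback 𝓘(ℝ, E) 𝓘(ℝ, E') e V y ∈ D y := by
    filter_upwards [he.continuousAt.eventually hV, e.open_source.mem_nhds hz] with y hy hys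
    exact (h.mpullback_mem_iff hys V).2 hy
  rw [← h.mpullback_mem_iff hz, mpullback_mlieBracket (n := ∞) (hX.mdifferentiableAt (by simp))
    (hY.mdifferentiableAt (by simp)) he minSmoothness_le_infty]
  exact hD _ _ (hsmooth hX) (hsmooth hY) (htangent hXD) (htangent hYD)

end Involutivity

section GraphDistribution

open VectorField

variable {E F : Type*} [NormedAddCommGroup E] [NormedSpace ℝ E]
  [NormedAddCommGroup F] [NormedSpace ℝ F]

theorem lieBracket_prodMk_clm_apply {a : E × F → E →L[ℝ] F} {p : E × F}
    (ha : DifferentiableAt ℝ a p) (v w : E) :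
    lieBracket ℝ (fun q => (v, a q v)) (fun q => (w, a q w)) p =
      (0, fderiv ℝ a p (v, a p v) w - fderiv ℝ a p (w, a p w) v) := by
  have hfderiv (v : E) (u : E × F) :
      fderiv ℝ (fun q => (v, a q v)) p u = (0, fderiv ℝ a p u v) := by
    rw [((hasFDerivAt_const v p).prodMk
      (ha.hasFDerivAt.clm_apply (hasFDerivAt_const v p))).fderiv]
    simp
  rw [lieBracket_eq]
  simp [hfderiv]

theorem totallyIntegrableOn_of_isInvolutiveAt_graph {a : E × F → E →L[ℝ] F} {W : Set (E × F)}
    (ha : ∀ p ∈ W, ContDiffAt ℝ ∞ a p)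
    (hinv : ∀ p ∈ W, IsInvolutiveAt (M := E × F) (fun z : E × F => (a z).toLinearMap.graph) p) :
    TotallyIntegrableOn a W := by
  intro p hp v w
  let X (v : E) (q : E × F) : TangentSpace 𝓘(ℝ, E × F) q := (v, a q v)
  have hX (v : E) : ContMDiffAt 𝓘(ℝ, E × F) 𝓘(ℝ, E × F).tangent ∞
      (fun q => (⟨q, X v q⟩ : TangentBundle 𝓘(ℝ, E × F) (E × F))) p :=
    contMDiffAt_vectorSpace_iff_contDiffAt.2
      (contDiffAt_const.prodMk ((ha p hp).clm_apply contDiffAt_const))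
  have hXgraph (v : E) (q : E × F) : X v q ∈ (a q).toLinearMap.graph :=
    (LinearMap.mem_graph_iff _ _).2 rfl
  have hmem := hinv p hp _ _ (hX v) (hX w) (.of_forall (hXgraph v)) (.of_forall (hXgraph w))
  rw [mlieBracket_eq_lieBracket] at hmem
  have hgraph : lieBracket ℝ (fun q => (v, a q v)) (fun q => (w, a q w)) p ∈
      (a p).toLinearMap.graph := hmem
  rw [lieBracket_prodMk_clm_apply ((ha p hp).differentiableAt (by simp)),
    LinearMap.mem_graph_iff] at hgraph
  simpa [sub_eq_zero] using hgraph

end GraphDistribution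

section LinearAlgebra

theorem ker_eq_graph_of_isInvertible_comp_inr {E₁ E₂ G : Type*}
    [NormedAddCommGroup E₁] [NormedSpace ℝ E₁] [NormedAddCommGroup E₂] [NormedSpace ℝ E₂]
    [NormedAddCommGroup G] [NormedSpace ℝ G] {C : E₁ × E₂ →L[ℝ] G}
    (hC : (C ∘L .inr ℝ E₁ E₂).IsInvertible) :
    C.ker = (-((C ∘L .inr ℝ E₁ E₂).inverse ∘L C ∘L .inl ℝ E₁ E₂)).toLinearMap.graph := by
  obtain ⟨B, hB⟩ := hC
  ext u
  have hsplit : C u = C (u.1, 0) + B u.2 := by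
    have hBu : B u.2 = C (0, u.2) := DFunLike.congr_fun hB u.2
    rw [hBu, ← map_add]
    simp
  rw [LinearMap.mem_ker, LinearMap.mem_graph_iff, ← hB]
  simp [hsplit, add_eq_zero_iff_eq_neg', ← B.symm.injective.eq_iff (b := -C (u.1, 0))]

theorem ker_comp_eq_ker_of_finrank_add {E W G : Type*} [NormedAddCommGroup E] [NormedSpace ℝ E]
    [FiniteDimensional ℝ E] [NormedAddCommGroup W] [NormedSpace ℝ W]
    [NormedAddCommGroup G] [NormedSpace ℝ G] {A : E →L[ℝ] W} {B : W →L[ℝ] G}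
    (hBA : Function.Surjective (B ∘L A))
    (hdim : Module.finrank ℝ G + Module.finrank ℝ A.ker = Module.finrank ℝ E) :
    (B ∘L A).ker = A.ker := by
  have hrank := (B ∘L A).toLinearMap.finrank_range_add_finrank_ker
  rw [LinearMap.range_eq_top.2 hBA, finrank_top] at hrank
  have hker : Module.finrank ℝ (B ∘L A).ker = Module.finrank ℝ A.ker := by omega
  exact (Submodule.eq_of_le_of_finrank_eq (LinearMap.ker_le_ker_comp _ _) hker.symm).symm

theorem exists_prodEquiv_leftInverse {E W : Type*} [NormedAddCommGroup E] [NormedSpace ℝ E]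
    [FiniteDimensional ℝ E] [NormedAddCommGroup W] [NormedSpace ℝ W] [FiniteDimensional ℝ W]
    (A : E →L[ℝ] W) :
    ∃ (E₂ : Submodule ℝ E) (ψ : E ≃L[ℝ] A.ker × E₂) (B : W →L[ℝ] E₂),
      (B ∘L A ∘L (ψ.symm : A.ker × E₂ →L[ℝ] E)) ∘L .inr ℝ A.ker E₂ = .id ℝ E₂ := by
  obtain ⟨E₂, hE₂⟩ := A.ker.exists_isCompl
  let ψ := (A.ker.prodEquivOfIsCompl E₂ hE₂).symm.toContinuousLinearEquiv
  have hψ (u : E₂) : ψ.symm (0, u) = u := by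
    simp [ψ]
  have hinj : LinearMap.ker (A.toLinearMap ∘ₗ E₂.subtype) = ⊥ := by
    rw [LinearMap.ker_comp, ← Submodule.disjoint_iff_comap_eq_bot]
    exact hE₂.disjoint.symm
  obtain ⟨B, hB⟩ := (A.toLinearMap ∘ₗ E₂.subtype).exists_leftInverse_of_injective hinj
  refine ⟨E₂, ψ, B.toContinuousLinearMap, ?_⟩
  ext u
  have hBu : B (A u) = u := DFunLike.congr_fun hB u
  simp [hψ, hBu]

end LinearAlgebra

section Frobenius

theorem exists_contDiff_eqOn {X Y : Type*} [NormedAddCommGroup X] [NormedSpace ℝ X]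
    [FiniteDimensional ℝ X] [NormedAddCommGroup Y] [NormedSpace ℝ Y] {f : X → Y} {O : Set X}
    (hO : IsOpen O) (hf : ContDiffOn ℝ ∞ f O) {x : X} (hx : x ∈ O) :
    ∃ (g : X → Y) (W : Set X), ContDiff ℝ ∞ g ∧ IsOpen W ∧ x ∈ W ∧ W ⊆ O ∧ Set.EqOn g f W := by
  obtain ⟨χ, hχO⟩ : ∃ χ : ContDiffBump x, tsupport χ ⊆ O := by
    obtain ⟨r, hr, hball⟩ := Metric.nhds_basis_closedBall.mem_iff.1 (hO.mem_nhds hx)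
    exact ⟨⟨r / 2, r, half_pos hr, half_lt_self hr⟩, by simpa only [ContDiffBump.tsupport_eq]⟩
  refine ⟨fun y => χ y • f y, Metric.ball x χ.rIn, ?_, Metric.isOpen_ball,
    Metric.mem_ball_self χ.rIn_pos, fun y hy => hχO (subset_tsupport _ ?_), fun y hy => ?_⟩
  · rw [← contMDiff_iff_contDiff]
    refine contMDiff_of_tsupport fun y hy => ContDiffAt.contMDiffAt ?_
    exact χ.contDiff.contDiffAt.smul
      (hf.contDiffAt (hO.mem_nhds (hχO (tsupport_smul_subset_left χ f hy))))
  · rw [χ.support_eq]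
    exact Metric.ball_subset_ball χ.rIn_lt_rOut.le hy
  · simp [χ.one_of_mem_closedBall (Metric.ball_subset_closedBall hy)]

theorem exists_mapsDistribution_of_affine {E E' : Type*} [NormedAddCommGroup E]
    [NormedSpace ℝ E] [NormedAddCommGroup E'] [NormedSpace ℝ E'] (ψ : E ≃L[ℝ] E') (p : E)
    {O : Set E} (hO : IsOpen O) {D : E → Submodule ℝ E} {D' : E' → Submodule ℝ E'}
    (h : ∀ z ∈ O, D z = (D' (ψ (z - p))).comap (ψ : E →ₗ[ℝ] E')) :
    ∃ e : OpenPartialHomeomorph E E', e.source = O ∧ (∀ z, e z = ψ (z - p)) ∧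
      MapsDistribution e D D' := by
  let e : OpenPartialHomeomorph E E' := ((Homeomorph.addRight (-p)).trans
    ψ.toHomeomorph).toOpenPartialHomeomorph.restrOpen O hO
  have hes : e.source = O := by simp [e]
  have he (z : E) : e z = ψ (z - p) := by simp [e, sub_eq_add_neg]
  have hderiv (z : E) : fderiv ℝ e z = ψ := by
    rw [funext he]
    exact (ψ.hasFDerivAt.comp z ((hasFDerivAt_id z).sub_const p)).fderiv
  refine ⟨e, hes, he, .of_contDiffOn ?_ ?_ fun z hz u => ?_⟩
  · rw [funext he]
    exact (ψ.contDiff.comp (contDiff_id.sub contDiff_const)).contDiffOn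
  · exact (ψ.symm.contDiff.add contDiff_const).contDiffOn
  · rw [hderiv, he, h z (hes ▸ hz)]
    rfl

variable {E : Type*} [NormedAddCommGroup E] [NormedSpace ℝ E] [FiniteDimensional ℝ E]
  {W : Type*} [NormedAddCommGroup W] [NormedSpace ℝ W] [FiniteDimensional ℝ W]
  {A : E → E →L[ℝ] W} {O : Set E} {k : ℕ}

theorem exists_mapsDistribution_ker_graph (hO : IsOpen O) (hA : ContDiffOn ℝ ∞ A O)
    (hk : ∀ z ∈ O, Module.finrank ℝ (A z).ker = k) {p : E} (hp : p ∈ O) :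
    ∃ (E₁ E₂ : Submodule ℝ E) (_ : E ≃L[ℝ] E₁ × E₂) (e : OpenPartialHomeomorph E (E₁ × E₂))
      (a : E₁ × E₂ → E₁ →L[ℝ] E₂), p ∈ e.source ∧ e.source ⊆ O ∧ e p = 0 ∧
        ContDiffOn ℝ ∞ a e.target ∧
        MapsDistribution e (fun z : E => (A z).ker) fun x : E₁ × E₂ => (a x).toLinearMap.graph := by
  obtain ⟨E₂, ψ, B, hB⟩ := exists_prodEquiv_leftInverse (A p)
  let C (z : E) : (A p).ker × E₂ →L[ℝ] E₂ :=
    B ∘L A z ∘L (ψ.symm : (A p).ker × E₂ →L[ℝ] E)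
  let a (z : E) : (A p).ker →L[ℝ] E₂ :=
    -((C z ∘L .inr ℝ (A p).ker E₂).inverse ∘L C z ∘L .inl ℝ (A p).ker E₂)
  have hC : ContDiffOn ℝ ∞ C O := contDiffOn_const.clm_comp (hA.clm_comp contDiffOn_const)
  have hCr : ContDiffOn ℝ ∞ (fun z => C z ∘L .inr ℝ (A p).ker E₂) O :=
    hC.clm_comp contDiffOn_const
  let O' : Set E := {z ∈ O | (C z ∘L .inr ℝ (A p).ker E₂).IsInvertible}
  have hO' : IsOpen O' := hCr.continuousOn.isOpen_inter_preimage hO ContinuousLinearEquiv.isOpen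
  have hO'O : O' ⊆ O := fun z hz => hz.1
  have hinverse : ContDiffOn ℝ ∞ (fun z => (C z ∘L .inr ℝ (A p).ker E₂).inverse) O' := fun z hz =>
    ContDiffAt.comp_contDiffWithinAt z (g := ContinuousLinearMap.inverse)
      hz.2.contDiffAt_map_inverse (hCr.mono hO'O z hz)
  have ha : ContDiffOn ℝ ∞ a O' :=
    (hinverse.clm_comp ((hC.mono hO'O).clm_comp contDiffOn_const)).neg
  have hker (z) (hz : z ∈ O') : (A z).ker = (a z).toLinearMap.graph.comap (ψ : E →ₗ[ℝ] _) := by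
    have hsurj : Function.Surjective (B ∘L A z) := fun y => by
      obtain ⟨w, rfl⟩ := hz.2.bijective.surjective y
      exact ⟨_, rfl⟩
    have hdim : Module.finrank ℝ E₂ + Module.finrank ℝ (A z).ker = Module.finrank ℝ E := by
      rw [ψ.toLinearEquiv.finrank_eq, Module.finrank_prod, hk z hz.1, hk p hp, add_comm]
    rw [← ker_comp_eq_ker_of_finrank_add hsurj hdim,
      ← ker_eq_graph_of_isInvertible_comp_inr hz.2]
    ext u
    simp [C]
  obtain ⟨e, hes, he, hmaps⟩ := exists_mapsDistribution_of_affine ψ p hO'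
    (D' := fun x => (a (ψ.symm x + p)).toLinearMap.graph) (by simpa using hker)
  refine ⟨(A p).ker, E₂, ψ, e, fun x => a (ψ.symm x + p), hes ▸ ⟨hp, .refl ℝ E₂, hB.symm⟩,
    hes ▸ hO'O, by simp [he],
    ha.comp (ψ.symm.contDiff.add contDiff_const).contDiffOn fun x hx => ?_, hmaps⟩
  have hx' : x = ψ (e.symm x - p) := by rw [← he, e.right_inv hx]
  rw [← hes, hx']
  simpa using e.map_target hx

theorem isCompletelyIntegrableOn_ker (hO : IsOpen O) (hA : ContDiffOn ℝ ∞ A O)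
    (hk : ∀ z ∈ O, Module.finrank ℝ (A z).ker = k)
    (hinv : ∀ z ∈ O, IsInvolutiveAt (M := E) (fun z : E => (A z).ker) z) :
    IsCompletelyIntegrableOn (M := E) (fun z : E => (A z).ker) O := by
  refine isCompletelyIntegrableOn_iff_mapsDistribution.2 fun p hp => ?_
  obtain ⟨E₁, E₂, ψ, e, a, hpe, heO, hep, ha, he⟩ := exists_mapsDistribution_ker_graph hO hA hk hp
  obtain ⟨b, V, hb, hV, hV0, hVe, hba⟩ :=
    exists_contDiff_eqOn e.open_target ha (hep ▸ e.map_source hpe)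
  obtain ⟨i, rfl, hi, hmi⟩ := exists_mapsDistribution_of_affine (.refl ℝ (E₁ × E₂)) 0 hV
    (D := fun x : E₁ × E₂ => (a x).toLinearMap.graph)
    (D' := fun x : E₁ × E₂ => (b x).toLinearMap.graph) fun x hx => by
      ext
      simp [hba hx]
  have hei := he.trans hmi
  have hint : TotallyIntegrableOn b i.source := by
    refine totallyIntegrableOn_of_isInvolutiveAt_graph (fun x _ => hb.contDiffAt) fun x hx => ?_
    have hx' : (e ≫ₕ i) (e.symm x) = x := by simp [hi, e.right_inv (hVe hx)]
    rw [← hx']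
    have hes := e.map_target (hVe hx)
    exact hei.isInvolutiveAt ⟨hes, by simpa [e.right_inv (hVe hx)] using hx⟩ (hinv _ (heO hes))
  obtain ⟨s, (hs0 : 0 ∈ s.source), -, hs⟩ :=
    hint.exists_mapsDistribution (a := ⟨b, hb.continuous⟩) hb hV hV0
  obtain ⟨l, hls, -, hl⟩ := exists_mapsDistribution_of_affine ψ.symm 0 isOpen_univ
    (D := fun _ => (⊤ : Submodule ℝ E₁).prod (⊥ : Submodule ℝ E₂))
    (D' := fun _ => ((⊤ : Submodule ℝ E₁).prod ⊥).comap (ψ : E →ₗ[ℝ] E₁ × E₂)) fun _ _ => by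
      ext
      simp
  exact ⟨(e ≫ₕ i) ≫ₕ s ≫ₕ l, _, by simpa [hpe, hep, hi, hls, hV0] using hs0,
    fun z hz => heO hz.1.1, hei.trans (hs.trans hl)⟩

end Frobenius

section Curvature

open VectorField

variable {E : Type*} [NormedAddCommGroup E] [NormedSpace ℝ E] {M : Type*} [TopologicalSpace M]
  [ChartedSpace E M] [IsManifold 𝓘(ℝ, E) ∞ M] {Γ : VectorOneForm E M} {z : M} {X Y : VField E M}

theorem horProj_apply (Γ : VectorOneForm E M) (z : M) (u : TangentSpace 𝓘(ℝ, E) z) :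
    horProj Γ z u = (1 / 2 : ℝ) • (u + Γ z u) :=
  rfl

theorem horProj_apply_horProj (hΓ : (Γ z).comp (Γ z) = .id ℝ _) (u : TangentSpace 𝓘(ℝ, E) z) :
    horProj Γ z (horProj Γ z u) = horProj Γ z u := by
  have hΓu : Γ z (Γ z u) = u := DFunLike.congr_fun hΓ u
  simp only [horProj_apply, map_smul, map_add, hΓu]
  module

theorem mem_horSpace_iff (hΓ : (Γ z).comp (Γ z) = .id ℝ _) {u : TangentSpace 𝓘(ℝ, E) z} :
    u ∈ horSpace Γ z ↔ horProj Γ z u = u := by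
  refine ⟨?_, fun hu => ⟨u, hu⟩⟩
  rintro ⟨u, rfl⟩
  exact horProj_apply_horProj hΓ u

theorem VectorOneForm.app_contMDiffAt (K : VectorOneForm E M) (hX : CMDiffAt ∞ (T% X) z) :
    CMDiffAt ∞ (T% (K.app X)) z :=
  ContMDiffAt.clm_bundle_apply (K.contMDiff z) hX

theorem app_horProj_eventuallyEq (hΓ : ∀ z, (Γ z).comp (Γ z) = .id ℝ _)
    (hX : ∀ᶠ y in 𝓝 z, X y ∈ horSpace Γ y) : (horProj Γ).app X =ᶠ[𝓝 z] X :=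
  hX.mono fun y hy => (mem_horSpace_iff (hΓ y)).1 hy

theorem exists_horizontal_extension (hΓ : ∀ z, (Γ z).comp (Γ z) = .id ℝ _)
    {u : TangentSpace 𝓘(ℝ, E) z} (hu : u ∈ horSpace Γ z) :
    ∃ X : VField E M, CMDiffAt ∞ (T% X) z ∧ X z = u ∧ ∀ y, X y ∈ horSpace Γ y := by
  refine ⟨(horProj Γ).app (FiberBundle.extend E u),
    VectorOneForm.app_contMDiffAt _ (FiberBundle.contMDiffAt_extend _ _ u), ?_,
    fun y => ⟨_, rfl⟩⟩
  rw [VectorOneForm.app, FiberBundle.extend_apply_self]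
  exact (mem_horSpace_iff (hΓ z)).1 hu

theorem eventually_mdifferentiableAt (hX : CMDiffAt ∞ (T% X) z) :
    ∀ᶠ y in 𝓝 z, MDiffAt (T% X) y :=
  ((contMDiffAt_iff_contMDiffAt_nhds (by simp)).1 (hX.of_le (m := 1) (by simp))).mono
    fun _ h => h.mdifferentiableAt (by simp)

theorem contMDiffAt_mlieBracket [CompleteSpace E] (hX : CMDiffAt ∞ (T% X) z)
    (hY : CMDiffAt ∞ (T% Y) z) : CMDiffAt ∞ (T% (mlieBracket 𝓘(ℝ, E) X Y)) z :=
  have : IsManifold 𝓘(ℝ, E) (∞ + 1) M := ‹IsManifold 𝓘(ℝ, E) ∞ M›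
  have : IsManifold 𝓘(ℝ, E) (minSmoothness ℝ 2) M := .of_le minSmoothness_le_infty
  ContMDiffAt.mlieBracket_vectorField (m := ⊤) (n := ⊤) hX hY (by simp)

variable [FiniteDimensional ℝ E]

theorem IsConnection.comp_self {L : VectorOneForm E M} (hL : IsAlmostTangent L)
    (hΓ : IsConnection L Γ) (z : M) : (Γ z).comp (Γ z) = .id ℝ _ := by
  ext u
  have hu : Γ z u - u ∈ LinearMap.ker (L z).toLinearMap := by
    rw [LinearMap.sub_mem_ker_iff]
    exact DFunLike.congr_fun (hΓ.comp_left z) u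
  rw [← hL.range_eq_ker z] at hu
  obtain ⟨w, hw : L z w = Γ z u - u⟩ := hu
  have hΓw : Γ z (L z w) = -L z w := DFunLike.congr_fun (hΓ.comp_right z) w
  rw [hw, map_sub, neg_sub] at hΓw
  exact sub_left_injective hΓw

theorem curvature_apply (hX : MDiffAt (T% X) z) (hY : MDiffAt (T% Y) z) :
    curvature Γ z (X z) (Y z) =
      horProj Γ z (mlieBracket 𝓘(ℝ, E) ((horProj Γ).app X) Y z) +
        horProj Γ z (mlieBracket 𝓘(ℝ, E) X ((horProj Γ).app Y) z) -
        mlieBracket 𝓘(ℝ, E) ((horProj Γ).app X) ((horProj Γ).app Y) z -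
        horProj Γ z (horProj Γ z (mlieBracket 𝓘(ℝ, E) X Y z)) := by
  have h : curvature Γ z (X z) (Y z) =
      (-(1 / 2) : ℝ) • fnBracket (horProj Γ) (horProj Γ) z (X z) (Y z) := by
    rw [neg_smul]
    rfl
  rw [h, fnBracket_apply _ _ hX hY, fnBracketField]
  module

theorem curvature_apply_of_eventually_mem_horSpace (hΓ : ∀ z, (Γ z).comp (Γ z) = .id ℝ _)
    (hX : MDiffAt (T% X) z) (hY : MDiffAt (T% Y) z) (hXh : ∀ᶠ y in 𝓝 z, X y ∈ horSpace Γ y) :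
    curvature Γ z (X z) (Y z) =
      horProj Γ z (mlieBracket 𝓘(ℝ, E) X ((horProj Γ).app Y) z) -
        mlieBracket 𝓘(ℝ, E) X ((horProj Γ).app Y) z := by
  have hhX (V : VField E M) : mlieBracket 𝓘(ℝ, E) ((horProj Γ).app X) V z =
      mlieBracket 𝓘(ℝ, E) X V z :=
    (app_horProj_eventuallyEq hΓ hXh).mlieBracket_vectorField_eq (.refl _ V)
  rw [curvature_apply hX hY, hhX, hhX, horProj_apply_horProj (hΓ z)]
  abel

theorem curvature_apply_horProj (hΓ : ∀ z, (Γ z).comp (Γ z) = .id ℝ _)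
    {u : TangentSpace 𝓘(ℝ, E) z} (hu : u ∈ horSpace Γ z) (w : TangentSpace 𝓘(ℝ, E) z) :
    curvature Γ z u (horProj Γ z w) = curvature Γ z u w := by
  obtain ⟨X, hX, rfl, hXh⟩ := exists_horizontal_extension hΓ hu
  have hXz : MDiffAt (T% X) z := hX.mdifferentiableAt (by simp)
  let W : VField E M := FiberBundle.extend E w
  have hWz : W z = w := FiberBundle.extend_apply_self E w
  have hW : MDiffAt (T% W) z := FiberBundle.mdifferentiableAt_extend _ _ w
  have hhW : (horProj Γ).app ((horProj Γ).app W) = (horProj Γ).app W :=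
    funext fun y => horProj_apply_horProj (hΓ y) (W y)
  have hR := curvature_apply_of_eventually_mem_horSpace hΓ hXz hW (.of_forall hXh)
  have hRh := curvature_apply_of_eventually_mem_horSpace hΓ hXz
    ((horProj Γ).app_mdifferentiableAt hW) (.of_forall hXh)
  rw [hhW, ← hR] at hRh
  simpa only [VectorOneForm.app, hWz] using hRh

theorem mem_nullity_iff (hΓ : ∀ z, (Γ z).comp (Γ z) = .id ℝ _) {u : TangentSpace 𝓘(ℝ, E) z} :
    u ∈ nullity Γ z ↔ u ∈ horSpace Γ z ∧ ∀ w ∈ horSpace Γ z, curvature Γ z u w = 0 := by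
  rw [mem_nullity]
  refine and_congr_right fun hu => ⟨fun h w _ => DFunLike.congr_fun h w, fun h => ?_⟩
  ext w
  rw [← curvature_apply_horProj hΓ hu w, h (horProj Γ z w) ⟨w, rfl⟩]
  rfl

theorem mlieBracket_mem_horSpace_iff (hΓ : ∀ z, (Γ z).comp (Γ z) = .id ℝ _)
    (hX : MDiffAt (T% X) z) (hY : MDiffAt (T% Y) z) (hXh : ∀ᶠ y in 𝓝 z, X y ∈ horSpace Γ y)
    (hYh : ∀ᶠ y in 𝓝 z, Y y ∈ horSpace Γ y) :
    mlieBracket 𝓘(ℝ, E) X Y z ∈ horSpace Γ z ↔ curvature Γ z (X z) (Y z) = 0 := by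
  rw [curvature_apply_of_eventually_mem_horSpace hΓ hX hY hXh, sub_eq_zero,
    Filter.EventuallyEq.mlieBracket_vectorField_eq (.refl _ X) (app_horProj_eventuallyEq hΓ hYh),
    mem_horSpace_iff (hΓ z)]

theorem eventually_mlieBracket_mem_horSpace (hΓ : ∀ z, (Γ z).comp (Γ z) = .id ℝ _)
    (hX : CMDiffAt ∞ (T% X) z) (hY : CMDiffAt ∞ (T% Y) z)
    (hXn : ∀ᶠ y in 𝓝 z, X y ∈ nullity Γ y) (hYh : ∀ᶠ y in 𝓝 z, Y y ∈ horSpace Γ y) :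
    ∀ᶠ y in 𝓝 z, mlieBracket 𝓘(ℝ, E) X Y y ∈ horSpace Γ y := by
  filter_upwards [eventually_mdifferentiableAt hX, eventually_mdifferentiableAt hY,
    hXn.eventually_nhds, hYh.eventually_nhds] with y hXy hYy hXn hYh
  rw [mlieBracket_mem_horSpace_iff hΓ hXy hYy (hXn.mono fun _ h => h.1) hYh]
  exact ((mem_nullity_iff hΓ).1 hXn.self_of_nhds).2 _ hYh.self_of_nhds

theorem isInvolutiveAt_nullity (hΓ : ∀ z, (Γ z).comp (Γ z) = .id ℝ _) (z : M) :
    IsInvolutiveAt (nullity Γ) z := by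
  have : CompleteSpace E := FiniteDimensional.complete ℝ E
  have : IsManifold 𝓘(ℝ, E) (minSmoothness ℝ 3) M := .of_le minSmoothness_le_infty
  intro X Y hX hY hXn hYn
  have hYh := hYn.mono fun _ h => h.1
  have hXYh := eventually_mlieBracket_mem_horSpace hΓ hX hY hXn hYh
  refine (mem_nullity_iff hΓ).2 ⟨hXYh.self_of_nhds, fun w hw => ?_⟩
  obtain ⟨Z, hZ, rfl, hZh⟩ := exists_horizontal_extension hΓ hw
  have hjacobi := leibniz_identity_mlieBracket_apply (𝕜 := ℝ) (hX.of_le minSmoothness_le_infty)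
    (hY.of_le minSmoothness_le_infty) (hZ.of_le minSmoothness_le_infty)
  have hXZh := eventually_mlieBracket_mem_horSpace hΓ hX hZ hXn (.of_forall hZh)
  have hYZh := eventually_mlieBracket_mem_horSpace hΓ hY hZ hYn (.of_forall hZh)
  have hXYZ := eventually_mlieBracket_mem_horSpace hΓ hX (contMDiffAt_mlieBracket hY hZ) hXn hYZh
  have hYXZ := eventually_mlieBracket_mem_horSpace hΓ hY (contMDiffAt_mlieBracket hX hZ) hYn hXZh
  rw [← mlieBracket_mem_horSpace_iff hΓ
    ((contMDiffAt_mlieBracket hX hY).mdifferentiableAt (by simp))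
    (hZ.mdifferentiableAt (by simp)) hXYh (.of_forall hZh), eq_sub_of_add_eq hjacobi.symm]
  exact sub_mem hXYZ.self_of_nhds hYXZ.self_of_nhds

end Curvature

section NullityForm

open VectorField

variable {E : Type*} [NormedAddCommGroup E] [NormedSpace ℝ E]
  {M : Type*} [TopologicalSpace M] [ChartedSpace E M]

theorem mdifferentiable_of_mem_maximalAtlas {φ : OpenPartialHomeomorph M E}
    (hφ : φ ∈ IsManifold.maximalAtlas 𝓘(ℝ, E) ∞ M) : φ.MDifferentiable 𝓘(ℝ, E) 𝓘(ℝ, E) :=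
  ⟨(contMDiffOn_of_mem_maximalAtlas hφ).mdifferentiableOn (by simp),
    (contMDiffOn_symm_of_mem_maximalAtlas hφ).mdifferentiableOn (by simp)⟩

variable [FiniteDimensional ℝ E] [IsManifold 𝓘(ℝ, E) ∞ M]

theorem contMDiffAt_curvature_apply (Γ : VectorOneForm E M) {X Y : VField E M} {z : M}
    (hX : CMDiffAt ∞ (T% X) z) (hY : CMDiffAt ∞ (T% Y) z) :
    CMDiffAt ∞ (T% fun y => curvature Γ y (X y) (Y y)) z := by
  have : CompleteSpace E := FiniteDimensional.complete ℝ E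
  let h := horProj Γ
  have hhX := h.app_contMDiffAt hX
  have hhY := h.app_contMDiffAt hY
  have hcurv : CMDiffAt ∞ (T% (h.app (mlieBracket 𝓘(ℝ, E) (h.app X) Y) +
      h.app (mlieBracket 𝓘(ℝ, E) X (h.app Y)) - mlieBracket 𝓘(ℝ, E) (h.app X) (h.app Y) -
      h.app (h.app (mlieBracket 𝓘(ℝ, E) X Y)))) z :=
    (((h.app_contMDiffAt (contMDiffAt_mlieBracket hhX hY)).add_section
      (h.app_contMDiffAt (contMDiffAt_mlieBracket hX hhY))).sub_section
      (contMDiffAt_mlieBracket hhX hhY)).sub_section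
      (h.app_contMDiffAt (h.app_contMDiffAt (contMDiffAt_mlieBracket hX hY)))
  refine hcurv.congr_of_eventuallyEq ?_
  filter_upwards [eventually_mdifferentiableAt hX, eventually_mdifferentiableAt hY] with y hXy hYy
  rw [curvature_apply hXy hYy]
  rfl

variable {Γ : VectorOneForm E M} {φ : OpenPartialHomeomorph M E}

/-- The coordinate frame of the chart `φ` at the point with coordinates `x`: the derivative at `x`
of `φ.symm`, with `T_x E` replaced by the fixed space `E`. -/
noncomputable def coordFrame (φ : OpenPartialHomeomorph M E) (x : E) :
    E →L[ℝ] TangentSpace 𝓘(ℝ, E) (φ.symm x) :=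
  mfderiv 𝓘(ℝ, E) 𝓘(ℝ, E) φ.symm x

/-- The coordinate expression, in the chart `φ`, of the linear map `X ↦ (X - h X, i_X R)`, whose
kernel is the nullity space of the curvature. -/
noncomputable def nullityForm (Γ : VectorOneForm E M) (φ : OpenPartialHomeomorph M E) (x : E) :
    E →L[ℝ] E × (E →L[ℝ] E) :=
  let S := coordFrame φ x
  (S.inverse ∘L (.id ℝ _ - horProj Γ (φ.symm x)) ∘L S).prod
    (S.inverse.postcomp E ∘L S.precomp _ ∘L curvature Γ (φ.symm x) ∘L S)

theorem nullityForm_apply (Γ : VectorOneForm E M) (φ : OpenPartialHomeomorph M E) (x u : E) :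
    nullityForm Γ φ x u =
      ((coordFrame φ x).inverse (coordFrame φ x u - horProj Γ _ (coordFrame φ x u)),
        (coordFrame φ x).inverse ∘L curvature Γ _ (coordFrame φ x u) ∘L coordFrame φ x) :=
  rfl

theorem mem_ker_nullityForm (hΓ : ∀ z, (Γ z).comp (Γ z) = .id ℝ _) {x u : E}
    (hx : (coordFrame φ x).IsInvertible) :
    u ∈ (nullityForm Γ φ x).ker ↔ coordFrame φ x u ∈ nullity Γ (φ.symm x) := by
  rw [mem_nullity, mem_horSpace_iff (hΓ _)]
  have hinj : Function.Injective (coordFrame φ x).inverse := hx.inverse.injective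
  rw [LinearMap.mem_ker, ContinuousLinearMap.coe_coe, nullityForm_apply, Prod.mk_eq_zero,
    map_eq_zero_iff _ hinj, sub_eq_zero, eq_comm]
  refine and_congr_right fun _ => ⟨fun h => ?_, fun h => ?_⟩
  · ext w
    obtain ⟨w, rfl⟩ := hx.surjective w
    exact hinj ((DFunLike.congr_fun h w).trans (map_zero _).symm)
  · ext w
    exact (congrArg (coordFrame φ x).inverse (DFunLike.congr_fun h (coordFrame φ x w))).trans
      (map_zero _)

variable (hφ : φ ∈ IsManifold.maximalAtlas 𝓘(ℝ, E) ∞ M)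
include hφ

theorem contDiffOn_coordFrame_inverse {V : VField E M}
    (hV : ∀ z ∈ φ.source, CMDiffAt ∞ (T% V) z) :
    ContDiffOn ℝ ∞ (fun x => (coordFrame φ x).inverse (V (φ.symm x))) φ.target := by
  have : IsManifold 𝓘(ℝ, E) (∞ + 1) M := ‹IsManifold 𝓘(ℝ, E) ∞ M›
  have : IsManifold 𝓘(ℝ, E) 1 M := .of_le (n := ∞) (by simp)
  have : CompleteSpace E := FiniteDimensional.complete ℝ E
  intro x hx
  have hsmooth : CMDiffAt ∞ (T% (mpullback 𝓘(ℝ, E) 𝓘(ℝ, E) φ.symm V)) x :=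
    (hV _ (φ.map_target hx)).mpullback_vectorField_preimage
      (contMDiffAt_symm_of_mem_maximalAtlas hφ hx)
      ⟨(mdifferentiable_of_mem_maximalAtlas hφ).symm.mfderiv hx, rfl⟩ (by simp)
  exact ((contMDiffAt_vectorSpace_iff_contDiffAt).1 hsmooth).contDiffWithinAt

theorem exists_contMDiffAt_eq_coordFrame (u : E) :
    ∃ V : VField E M, (∀ z ∈ φ.source, CMDiffAt ∞ (T% V) z) ∧
      ∀ x ∈ φ.target, V (φ.symm x) = coordFrame φ x u := by
  have : IsManifold 𝓘(ℝ, E) (∞ + 1) M := ‹IsManifold 𝓘(ℝ, E) ∞ M›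
  have : IsManifold 𝓘(ℝ, E) 1 M := .of_le (n := ∞) (by simp)
  have : CompleteSpace E := FiniteDimensional.complete ℝ E
  have hdiff := mdifferentiable_of_mem_maximalAtlas hφ
  have hu : ContMDiff 𝓘(ℝ, E) 𝓘(ℝ, E).tangent ∞ fun y => (⟨y, u⟩ : TangentBundle 𝓘(ℝ, E) E) :=
    contMDiff_vectorSpace_iff_contDiff.2 contDiff_const
  refine ⟨mpullback 𝓘(ℝ, E) 𝓘(ℝ, E) φ (fun _ => u), fun z hz => ?_, fun x hx => ?_⟩
  · exact (hu (φ z)).mpullback_vectorField_preimage (contMDiffAt_of_mem_maximalAtlas hφ hz)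
      ⟨hdiff.mfderiv hz, rfl⟩ (by simp)
  · have hSu : mfderiv 𝓘(ℝ, E) 𝓘(ℝ, E) φ (φ.symm x) (coordFrame φ x u) = u :=
      DFunLike.congr_fun (hdiff.comp_symm_deriv hx) u
    have hinv : (mfderiv 𝓘(ℝ, E) 𝓘(ℝ, E) φ (φ.symm x)).IsInvertible :=
      ⟨hdiff.mfderiv (φ.map_target hx), rfl⟩
    exact hinv.inverse_apply_eq.2 hSu.symm

theorem contDiffOn_nullityForm (Γ : VectorOneForm E M) :
    ContDiffOn ℝ ∞ (nullityForm Γ φ) φ.target := by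
  refine contDiffOn_clm_apply.2 fun u => ?_
  obtain ⟨U, hU, hUu⟩ := exists_contMDiffAt_eq_coordFrame hφ u
  simp only [nullityForm_apply]
  refine .prodMk ?_ (contDiffOn_clm_apply.2 fun w => ?_)
  · refine (contDiffOn_coordFrame_inverse hφ fun z hz => (hU z hz).sub_section
      ((horProj Γ).app_contMDiffAt (hU z hz))).congr fun x hx => ?_
    rw [Pi.sub_apply, VectorOneForm.app, hUu x hx]
  · obtain ⟨W, hW, hWw⟩ := exists_contMDiffAt_eq_coordFrame hφ w
    refine (contDiffOn_coordFrame_inverse hφ fun z hz =>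
      contMDiffAt_curvature_apply Γ (hU z hz) (hW z hz)).congr fun x hx => ?_
    rw [hUu x hx, hWw x hx]
    rfl

theorem mapsDistribution_nullity_ker (hΓ : ∀ z, (Γ z).comp (Γ z) = .id ℝ _) :
    MapsDistribution (E := E) (E' := E) φ.symm (fun x => (nullityForm Γ φ x).ker) (nullity Γ) where
  contMDiffOn := contMDiffOn_symm_of_mem_maximalAtlas hφ
  contMDiffOn_symm := by simpa using contMDiffOn_of_mem_maximalAtlas hφ
  mem_iff _ hx _ := mem_ker_nullityForm hΓ
    ⟨(mdifferentiable_of_mem_maximalAtlas hφ).symm.mfderiv hx, rfl⟩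

end NullityForm

end LConn

open LConn in
theorem theorem8_general {E : Type*} [NormedAddCommGroup E] [NormedSpace ℝ E]
    [FiniteDimensional ℝ E] {M : Type*} [TopologicalSpace M] [ChartedSpace E M]
    [IsManifold 𝓘(ℝ, E) ∞ M] (Γ : VectorOneForm E M) (hΓ : ∀ z, (Γ z).comp (Γ z) = .id ℝ _)
    (U : Set M) (hU : IsOpen U) (k : ℕ) (hk : ∀ z ∈ U, nullityIndex Γ z = k) :
    IsCompletelyIntegrableOn (nullity Γ) U := by
  refine .of_mapsDistribution fun p hp => ?_
  let φ := (chartAt E p).restr U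
  have hφ : φ ∈ IsManifold.maximalAtlas 𝓘(ℝ, E) ∞ M :=
    restr_mem_maximalAtlas _ (IsManifold.chart_mem_maximalAtlas p) hU
  have hφU : φ.source = (chartAt E p).source ∩ U := (chartAt E p).restr_source' U hU
  have hsymm := mapsDistribution_nullity_ker hφ hΓ
  have hmaps : MapsDistribution φ (nullity Γ) fun x => (nullityForm Γ φ x).ker := hsymm.symm
  refine ⟨φ, hφU ▸ ⟨mem_chart_source E p, hp⟩, fun z hz => (hφU ▸ hz).2, _, hmaps,
    isCompletelyIntegrableOn_ker (k := k) φ.open_target (contDiffOn_nullityForm hφ Γ)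
      (fun x hx => ?_) fun x hx => ?_⟩
  · exact (hsymm.finrank_eq hx).trans (hk _ (hφU ▸ φ.map_target hx).2)
  · rw [← φ.right_inv hx]
    exact hmaps.isInvolutiveAt (φ.map_target hx) (isInvolutiveAt_nullity hΓ _)

theorem theorem8 {E : Type*} [NormedAddCommGroup E] [NormedSpace ℝ E] [FiniteDimensional ℝ E]
    {M : Type*} [TopologicalSpace M] [T2Space M] [ParacompactSpace M]
    [ChartedSpace E M] [IsManifold 𝓘(ℝ, E) ∞ M]
    (L : LConn.VectorOneForm E M) (hL : LConn.IsAlmostTangent L)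
    (Γ : LConn.VectorOneForm E M) (hΓ : LConn.IsConnection L Γ)
    (U : Set M) (hU : IsOpen U) (k : ℕ) (hk : ∀ z ∈ U, LConn.nullityIndex Γ z = k) :
    LConn.IsCompletelyIntegrableOn (LConn.nullity Γ) U :=
  theorem8_general Γ (hΓ.comp_self hL) U hU k hk
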